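/- All graphs are finite and simple. For a vertex $v$ of a graph $G$ let $N[v]=\{v\}\cup N(v)$ be its closed neighbourhood. A set $X\subseteq V(G)$ is a $2$-limited packing if $|N[v]\cap X|\le 2$ for every $v\in V(G)$, and $L_2(G)$ is the maximum size of a $2$-limited packing of $G$. A set $D\subseteq V(G)$ is a double dominating set if $|N[v]\cap D|\ge 2$ for every $v\in V(G)$, and $\gamma_{\times 2}(G)$ is the minimum size of a double dominating set of $G$ (if there is one, as is the case for every cubic graph). Let $H_6$ be the $6$-cycle with its three chords joining opposite vertices added. Then: 1. Every graph $G$ with maximum degree $\Delta(G)=3$ satisfies $L_2(G)\ge |V(G)|/3$. 2. Every cubic (that is, $3$-regular) graph $G$ on $n$ vertices satisfies $L_2(G)+\gamma_{\times 2}(G)=n$ and $\gamma_{\times 2}(G)\le 2n/3$. 3. Both bounds are tight: for every $m\ge 1$, the disjoint union $G$ of $m$ copies of $H_6$ is a cubic graph (so $\Delta(G)=3$) with $L_2(G)=|V(G)|/3$ and $\gamma_{\times 2}(G)=2|V(G)|/3$. -/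

import Mathlib

universe u

/-- The closed neighbourhood `N[v] = {v} ∪ N(v)` of a vertex. -/
def closedNbhd {V : Type u} [Fintype V] [DecidableEq V] (G : SimpleGraph V) [DecidableRel G.Adj]
    (v : V) : Finset V :=
  insert v (G.neighborFinset v)

/-- `X` is a `k`-limited packing: every closed neighbourhood has at most `k` elements of `X`. -/
def IsLimitedPacking {V : Type u} [Fintype V] [DecidableEq V] (G : SimpleGraph V)
    [DecidableRel G.Adj] (k : ℕ) (X : Finset V) : Prop :=
  ∀ v : V, (closedNbhd G v ∩ X).card ≤ k

/-- The `k`-limited packing number `L_k(G)`: the maximum size of a `k`-limited packing. -/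
noncomputable def limitedPackingNumber {V : Type u} [Fintype V] [DecidableEq V]
    (G : SimpleGraph V) [DecidableRel G.Adj] (k : ℕ) : ℕ :=
  sSup {n : ℕ | ∃ X : Finset V, IsLimitedPacking G k X ∧ X.card = n}

/-- `D` is an `l`-tuple dominating set: every closed neighbourhood has at least `l` elements
of `D`. -/
def IsTupleDominating {V : Type u} [Fintype V] [DecidableEq V] (G : SimpleGraph V)
    [DecidableRel G.Adj] (l : ℕ) (D : Finset V) : Prop :=
  ∀ v : V, l ≤ (closedNbhd G v ∩ D).card

/-- The `l`-tuple domination number `γ_{×l}(G)`: the minimum size of an `l`-tuple dominating set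
(for `l = 2`, the double domination number). -/
noncomputable def tupleDominationNumber {V : Type u} [Fintype V] [DecidableEq V]
    (G : SimpleGraph V) [DecidableRel G.Adj] (l : ℕ) : ℕ :=
  sInf {n : ℕ | ∃ D : Finset V, IsTupleDominating G l D ∧ D.card = n}

/-- The supremum defining `L_k(G)` is always an attained maximum. -/
theorem isGreatest_limitedPackingNumber {V : Type u} [Fintype V] [DecidableEq V]
    (G : SimpleGraph V) [DecidableRel G.Adj] (k : ℕ) :
    IsGreatest {n : ℕ | ∃ X : Finset V, IsLimitedPacking G k X ∧ X.card = n}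
      (limitedPackingNumber G k) := by
  have hb : BddAbove {n : ℕ | ∃ X : Finset V, IsLimitedPacking G k X ∧ X.card = n} :=
    ⟨Fintype.card V, by rintro n ⟨X, -, rfl⟩; exact X.card_le_univ⟩
  refine ⟨Nat.sSup_mem ⟨0, ∅, fun v => by simp, rfl⟩ hb, fun n hn => le_csSup hb hn⟩

/-- In a graph that is regular of degree at least `l - 1`, the infimum defining `γ_{×l}(G)` is an
attained minimum. -/
theorem isLeast_tupleDominationNumber {V : Type u} [Fintype V] [DecidableEq V]
    (G : SimpleGraph V) [DecidableRel G.Adj] (r l : ℕ) (hG : G.IsRegularOfDegree r)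
    (hl : l ≤ r + 1) :
    IsLeast {n : ℕ | ∃ D : Finset V, IsTupleDominating G l D ∧ D.card = n}
      (tupleDominationNumber G l) := by
  refine ⟨Nat.sInf_mem ⟨_, Finset.univ, fun v => ?_, rfl⟩, fun n hn => Nat.sInf_le hn⟩
  rw [Finset.inter_univ, closedNbhd, Finset.card_insert_of_notMem (by simp),
    SimpleGraph.card_neighborFinset_eq_degree, hG.degree_eq v]
  exact hl

/-- The graph `H_6`: a 6-cycle on `0, …, 5` together with its three chords of length 3
(addition is modulo 6). -/
def graphH6 : SimpleGraph (Fin 6) where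
  Adj i j := j = i + 1 ∨ i = j + 1 ∨ j = i + 3
  symm := ⟨by decide⟩
  loopless := ⟨by decide⟩

instance : DecidableRel graphH6.Adj := fun i j =>
  inferInstanceAs (Decidable (j = i + 1 ∨ i = j + 1 ∨ j = i + 3))

/-- The disjoint union of `m` copies of a graph `G`. -/
def disjointCopies {V : Type u} (m : ℕ) (G : SimpleGraph V) : SimpleGraph (Fin m × V) where
  Adj p q := p.1 = q.1 ∧ G.Adj p.2 q.2
  symm := ⟨fun _ _ h => ⟨h.1.symm, h.2.symm⟩⟩
  loopless := ⟨fun _ h => G.loopless.irrefl _ h.2⟩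

instance {V : Type u} (m : ℕ) (G : SimpleGraph V) [DecidableRel G.Adj] :
    DecidableRel (disjointCopies m G).Adj := fun p q =>
  inferInstanceAs (Decidable (p.1 = q.1 ∧ G.Adj p.2 q.2))

/-! The lower bound comes from a partition: the vertices of any subcubic graph split into three
2-limited packings (`SimpleGraph.exists_isPackingColoring`), and the largest class contains at least
a third of them.

Padding with isolated vertices makes the order even. A bridge can be deleted: after colouring the
rest, a permutation of the colours on one side repairs the two closed neighbourhoods involved
(`exists_isPackingColoring_of_bridge`). Without bridges, Tutte's theorem gives a matching `m`
covering all vertices of degree three (`exists_matching_of_no_bridge`). Then `N[v]` consists of `v`,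
its mate if there is one, and at most two unmatched neighbours. If mates differ in colour, and so do
the two unmatched neighbours of each vertex, no colour occurs three times in `N[v]`.

These demands are the edges of `pairingGraph`, whose degrees are at most three, so Brooks' theorem
colours everything except its 4-cliques, which are whole components. On a 4-clique one colour must
be repeated. It is put on two vertices `a`, `b` that are the unmatched neighbours of exactly one
vertex `x`, the centre; this is harmless if neither `x` nor its mate has that colour. If `x` is
already coloured, such a colour exists (`GoodOn.extend`). Otherwise `x` lies in another 4-clique,
which can be given a centre in the first one, and both are coloured together (`GoodOn.extend_pair`).

In a cubic graph closed neighbourhoods have four elements, so complements exchange 2-limited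
packings and double dominating sets. For tightness, `graphH6` is `K_{3,3}`, where no three vertices
form a 2-limited packing. -/

/-! ### Brooks' theorem for maximum degree three -/

/-- `c` is a proper colouring of the subgraph of `F` induced by `A`. -/
def ProperOn {V : Type*} {α : Type*} (F : SimpleGraph V) (A : Finset V) (c : V → α) : Prop :=
  ∀ u ∈ A, ∀ w ∈ A, F.Adj u w → c u ≠ c w

namespace ProperOn

variable {V : Type*} {F : SimpleGraph V}

/-- With one neighbour disregarded, at most two colours are seen. This is the greedy step: `n` is
either still uncoloured or repeats the colour of another neighbour. -/
theorem exists_color_avoiding_neighbors_except [Finite V] (hF : ∀ v, (F.neighborSet v).ncard ≤ 3)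
    (c : V → Fin 3) {v n : V} (hn : F.Adj v n) :
    ∃ t, ∀ w, F.Adj v w → w ≠ n → c w ≠ t := by
  classical
  have h1 : (c '' (F.neighborSet v \ {n})).ncard ≤ 2 := by
    refine (Set.ncard_image_le (Set.toFinite _)).trans ?_
    have := Set.ncard_sdiff_singleton_add_one (s := F.neighborSet v) (a := n) hn (Set.toFinite _)
    have := hF v
    omega
  have h2 : c '' (F.neighborSet v \ {n}) ≠ Set.univ := by
    intro h
    rw [h, Set.ncard_univ, Nat.card_eq_fintype_card, Fintype.card_fin] at h1
    omega
  obtain ⟨t, ht⟩ := (Set.ne_univ_iff_exists_notMem _).1 h2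
  exact ⟨t, fun w hw hwn hc => ht ⟨w, ⟨hw, hwn⟩, hc⟩⟩

theorem update_insert [DecidableEq V] {A : Finset V} {c : V → Fin 3} (h : ProperOn F A c) {v : V} (hv : v ∉ A)
    {t : Fin 3} (ht : ∀ w ∈ A, F.Adj v w → c w ≠ t) :
    ProperOn F (insert v A) (Function.update c v t) := by
  intro a ha b hb hab
  have hne := hab.ne
  rcases Finset.mem_insert.1 ha with rfl | ha
  · rcases Finset.mem_insert.1 hb with rfl | hb
    · exact absurd rfl hne
    · simpa [Function.update_of_ne hne.symm] using (ht b hb hab).symm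
  · have ha' := ha
    have hav : a ≠ v := fun e => hv (e ▸ ha)
    rcases Finset.mem_insert.1 hb with hbv | hb
    · subst hbv
      simpa [Function.update_of_ne hav] using ht a ha' hab.symm
    · have hbv : b ≠ v := fun e => hv (e ▸ hb)
      simpa [Function.update_of_ne hav, Function.update_of_ne hbv] using h a ha b hb hab

/-- Colour greedily along a path, except for its last vertex. -/
theorem extend_path [Finite V] [DecidableEq V] (hF : ∀ v, (F.neighborSet v).ncard ≤ 3) (L : List V) (u : V) :
    ∀ (A : Finset V) (c : V → Fin 3), ProperOn F A c → (L ++ [u]).IsChain F.Adj →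
      (L ++ [u]).Nodup → (∀ x ∈ L ++ [u], x ∉ A) →
      ∃ c' : V → Fin 3, (∀ a ∈ A, c' a = c a) ∧ ProperOn F (A ∪ L.toFinset) c' := by
  induction L with
  | nil => intro A c h _ _ _; exact ⟨c, fun _ _ => rfl, by simpa using h⟩
  | cons v L ih =>
    intro A c h hch hnd hdis
    obtain ⟨n, hn, hnL⟩ : ∃ n, F.Adj v n ∧ n ∈ L ++ [u] := by
      cases L with
      | nil => exact ⟨u, by simpa using hch, by simp⟩
      | cons n L =>
        simp only [List.cons_append, List.isChain_cons_cons] at hch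
        exact ⟨n, hch.1, by simp⟩
    obtain ⟨t, ht⟩ := exists_color_avoiding_neighbors_except hF c hn
    have hvA : v ∉ A := hdis v (by simp)
    have hnA : n ∉ A := hdis n (by simp only [List.cons_append, List.mem_cons, hnL, or_true])
    have h' := h.update_insert hvA (t := t) (fun w hw hvw => ht w hvw (fun e => hnA (e ▸ hw)))
    rw [List.cons_append] at hch hnd hdis
    obtain ⟨c', hc', hp⟩ := ih _ _ h' hch.tail (List.nodup_cons.1 hnd).2 (by
      intro x hx hxA
      rcases Finset.mem_insert.1 hxA with rfl | hxA
      · exact (List.nodup_cons.1 hnd).1 hx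
      · exact hdis x (List.mem_cons_of_mem _ hx) hxA)
    refine ⟨c', fun a ha => ?_, ?_⟩
    · rw [hc' a (Finset.mem_insert_of_mem ha), Function.update_of_ne (ne_of_mem_of_not_mem ha hvA)]
    · convert hp using 1
      ext x; simp

/-- Colour greedily along a path whose last vertex has two neighbours of the same colour. -/
theorem extend_path_closing [Finite V] [DecidableEq V] (hF : ∀ v, (F.neighborSet v).ncard ≤ 3) {L : List V} {u p q : V}
    {A : Finset V} {c : V → Fin 3} (h : ProperOn F A c) (hch : (L ++ [u]).IsChain F.Adj)
    (hnd : (L ++ [u]).Nodup) (hdis : ∀ x ∈ L ++ [u], x ∉ A) (hp : p ∈ A) (hq : q ∈ A)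
    (hpq : p ≠ q) (hup : F.Adj u p) (huq : F.Adj u q) (hc : c p = c q) :
    ∃ c' : V → Fin 3, ProperOn F (A ∪ (L ++ [u]).toFinset) c' := by
  obtain ⟨c', hc', hP⟩ := extend_path hF L u A c h hch hnd hdis
  obtain ⟨t, ht⟩ := exists_color_avoiding_neighbors_except hF c' hup
  have huA : u ∉ A ∪ L.toFinset := by
    have h1 := hdis u (by simp)
    have h2 : u ∉ L := fun hu => (List.disjoint_of_nodup_append hnd) hu (by simp)
    simp [h1, h2]
  have := hP.update_insert huA (t := t) (fun w _ huw => by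
    by_cases e : w = p
    · rw [e, hc' p hp, hc, ← hc' q hq]
      exact ht q huq hpq.symm
    · exact ht w huw e)
  refine ⟨Function.update c' u t, ?_⟩
  convert this using 1
  ext x; simp

theorem of_closed_union {A B : Finset V} {c c' : V → Fin 3} [DecidableEq V]
    (hA : ProperOn F A c) (hB : ProperOn F B c') (hcl : ∀ u ∈ B, ∀ w, F.Adj u w → w ∈ B) :
    ProperOn F (A ∪ B) (fun v => if v ∈ B then c' v else c v) := by
  intro u hu w hw huw
  by_cases h1 : u ∈ B
  · have h2 := hcl u h1 w huw
    simpa [h1, h2] using hB u h1 w h2 huw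
  · have h2 : w ∉ B := fun h => h1 (hcl w h u huw.symm)
    simp only [Finset.mem_union, h1, h2, or_false] at hu hw
    simpa [h1, h2] using hA u hu w hw huw

/-- A longest path that ends with the given vertices cannot be extended at its start. -/
theorem exists_maximal_path [DecidableEq V] {A : Finset V} {s : List V} (hs : s.IsChain F.Adj)
    (hnd : s.Nodup) (hsA : ∀ x ∈ s, x ∈ A) :
    ∃ p : List V, (p ++ s).IsChain F.Adj ∧ (p ++ s).Nodup ∧ (∀ x ∈ p ++ s, x ∈ A) ∧
      ∀ y ∈ A, (y :: (p ++ s)).IsChain F.Adj → y ∈ p ++ s := by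
  by_contra! hcon
  have key : ∀ n : ℕ, ∃ p : List V, p.length = n ∧ (p ++ s).IsChain F.Adj ∧ (p ++ s).Nodup ∧
      (∀ x ∈ p ++ s, x ∈ A) := by
    intro n
    induction n with
    | zero => exact ⟨[], rfl, hs, hnd, hsA⟩
    | succ n ih =>
      obtain ⟨p, hp, h1, h2, h3⟩ := ih
      obtain ⟨y, hy, h4, h5⟩ := hcon p h1 h2 h3
      refine ⟨y :: p, by simp [hp], h4, List.nodup_cons.2 ⟨h5, h2⟩, ?_⟩
      intro x hx
      rcases List.mem_cons.1 hx with rfl | hx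
      · exact hy
      · exact h3 x hx
  obtain ⟨p, hp, -, h2, h3⟩ := key (A.card + 1)
  have h4 : (p ++ s).toFinset.card ≤ A.card :=
    Finset.card_le_card fun x hx => h3 x (List.mem_toFinset.1 hx)
  rw [List.toFinset_card_of_nodup h2, List.length_append] at h4
  omega

end ProperOn

theorem List.exists_eq_append_step {α : Type*} {p : α → Prop} {l : List α} :
    (∀ h ∈ l.head?, ¬ p h) → (∃ x ∈ l, p x) →
      ∃ (P : List α) (w u : α) (Q : List α), l = P ++ w :: u :: Q ∧ ¬ p w ∧ p u := by
  induction l with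
  | nil => simp
  | cons h T ih =>
    intro hh hx
    have hh' : ¬ p h := hh h rfl
    cases T with
    | nil => simp [hh'] at hx
    | cons y T =>
      by_cases hy : p y
      · exact ⟨[], h, y, T, rfl, hh', hy⟩
      · obtain ⟨P, w, u, Q, h1, h2, h3⟩ := ih (by simpa using hy) (by simpa [hh'] using hx)
        exact ⟨h :: P, w, u, Q, by rw [h1]; rfl, h2, h3⟩

theorem List.exists_eq_append_last {α : Type*} {p : α → Prop} {l : List α} :
    (∃ x ∈ l, p x) → ∃ (C : List α) (x : α) (D : List α), l = C ++ x :: D ∧ p x ∧ ∀ d ∈ D, ¬ p d := by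
  induction l with
  | nil => simp
  | cons h T ih =>
    intro hx
    by_cases hT : ∃ x ∈ T, p x
    · obtain ⟨C, x, D, h1, h2, h3⟩ := ih hT
      exact ⟨h :: C, x, D, by rw [h1]; rfl, h2, h3⟩
    · obtain ⟨x, hx, hpx⟩ := hx
      push Not at hT
      rcases List.mem_cons.1 hx with rfl | hx
      · exact ⟨[], x, T, rfl, hpx, hT⟩
      · exact absurd hpx (hT x hx)

namespace ProperOn

variable {V : Type*} [Finite V] [DecidableEq V] {F : SimpleGraph V}

/-- A colouring of the complement of a cycle extends to the cycle if some vertex of the cycle has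
all its neighbours on the cycle and some other vertex does not. -/
theorem exists_of_cycle (hF : ∀ v, (F.neighborSet v).ncard ≤ 3) {A : Finset V}
    (hcl : ∀ u ∈ A, ∀ w, F.Adj u w → w ∈ A) {C : List V} (hch : C.IsChain F.Adj) (hnd : C.Nodup)
    (hCA : ∀ x ∈ C, x ∈ A) (hcyc : ∀ x ∈ C.head?, ∀ y ∈ C.getLast?, F.Adj x y)
    (hhead : ∀ h ∈ C.head?, ∀ w, F.Adj h w → w ∈ C)
    (hout : ∃ x ∈ C, ∃ y, F.Adj x y ∧ y ∉ C)
    (hmin : ∃ c : V → Fin 3, ProperOn F (A \ C.toFinset) c) :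
    ∃ c : V → Fin 3, ProperOn F A c := by
  obtain ⟨P, w, u, Q, hC, hw, y, huy, hyC⟩ := List.exists_eq_append_step
    (p := fun x => ∃ y, F.Adj x y ∧ y ∉ C) (by
      rintro h hh ⟨y, h1, h2⟩
      exact h2 (hhead h hh y h1)) hout
  push Not at hw
  obtain ⟨c, hc⟩ := hmin
  have hwC : w ∈ C := by simp [hC]
  have huC : u ∈ C := by simp [hC]
  have hyw : y ≠ w := fun e => hyC (e ▸ hwC)
  have hw' : w ∉ A \ C.toFinset := by simp [hwC]
  -- All neighbours of `w` lie on the uncoloured cycle, so its colour is free. Copying the colour of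
  -- `y` makes `u` see that colour twice.
  have h1 := hc.update_insert hw' (t := c y) (by
    intro x hx hwx
    exact absurd (hw x hwx) (by simpa using (Finset.mem_sdiff.1 hx).2))
  subst hC
  rw [List.isChain_append] at hch
  obtain ⟨hP, hQ, hPQ⟩ := hch
  simp only [List.isChain_cons_cons] at hQ
  have hsymm : ∀ l : List V, l.IsChain F.Adj → l.reverse.IsChain F.Adj := by
    intro l hl
    rw [List.isChain_reverse]
    exact hl.imp fun a b h => h.symm
  -- From `w` run backwards to the head of the cycle, across the closing edge to its last vertex,
  -- and backwards again to `u`.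
  have hchain : ((P.reverse ++ Q.reverse) ++ [u]).IsChain F.Adj := by
    have : (P.reverse ++ Q.reverse) ++ [u] = P.reverse ++ (u :: Q).reverse := by simp
    rw [this, List.isChain_append]
    refine ⟨hsymm _ hP, hsymm _ hQ.2, ?_⟩
    intro a ha b hb
    rw [List.getLast?_reverse] at ha
    rw [List.head?_reverse] at hb
    refine hcyc a ?_ b ?_
    · rw [List.head?_append, Option.mem_def.1 ha]; rfl
    · rw [List.getLast?_append]
      simpa [List.getLast?_cons_cons] using hb
  have hperm : ((P.reverse ++ Q.reverse) ++ [u]).Perm (P ++ u :: Q) := by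
    have h2 : ((P.reverse ++ Q.reverse) ++ [u]) = P.reverse ++ (u :: Q).reverse := by simp
    rw [h2]
    exact (List.reverse_perm _).append (List.reverse_perm _)
  have hsub : (P ++ u :: Q).Sublist (P ++ w :: u :: Q) :=
    (List.Sublist.refl _).append (List.sublist_cons_self _ _)
  have hwn : w ∉ P ++ u :: Q := by
    have := (List.nodup_middle.1 hnd)
    exact (List.nodup_cons.1 this).1
  obtain ⟨c', hc'⟩ := extend_path_closing hF (p := y) (q := w) h1 hchain
    (hperm.nodup_iff.2 (hsub.nodup hnd)) (by
      intro x hx hx'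
      have hx := hperm.mem_iff.1 hx
      rcases Finset.mem_insert.1 hx' with rfl | hx'
      · exact hwn hx
      · exact (Finset.mem_sdiff.1 hx').2 (List.mem_toFinset.2 (hsub.subset hx)))
    (by
      refine Finset.mem_insert_of_mem (Finset.mem_sdiff.2 ⟨hcl u (hCA u huC) y huy, ?_⟩)
      simpa only [List.mem_toFinset] using hyC)
    (Finset.mem_insert_self _ _) hyw huy hQ.1.symm
    (by rw [Function.update_self, Function.update_of_ne hyw])
  refine ⟨c', fun a ha b hb hab => hc' a ?_ b ?_ hab⟩
  · by_cases h : a ∈ P ++ w :: u :: Q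
    · simp only [List.mem_append, List.mem_cons] at h
      simp; tauto
    · simp [ha]; simp at h; tauto
  · by_cases h : b ∈ P ++ w :: u :: Q
    · simp only [List.mem_append, List.mem_cons] at h
      simp; tauto
    · simp [hb]; simp at h; tauto

/-- Colouring along a Hamiltonian path that starts with two non-adjacent neighbours of its second
vertex. -/
theorem exists_of_hamiltonian (hF : ∀ v, (F.neighborSet v).ncard ≤ 3) {A : Finset V} {p : List V}
    {x₁ x₂ x₃ z : V} (hch : (p ++ [x₃, x₂, x₁]).IsChain F.Adj) (hnd : (p ++ [x₃, x₂, x₁]).Nodup)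
    (hA : (p ++ [x₃, x₂, x₁]).toFinset = A) (h13 : ¬ F.Adj x₁ x₃) (hz : F.Adj x₂ z) (hzp : z ∈ p) :
    ∃ c : V → Fin 3, ProperOn F A c := by
  obtain ⟨q₁, q₂, rfl⟩ := List.append_of_mem hzp
  have h0 : ProperOn F {x₁, x₃} (fun _ => (0 : Fin 3)) := by
    intro a ha b hb hab
    simp only [Finset.mem_insert, Finset.mem_singleton] at ha hb
    rcases ha with rfl | rfl <;> rcases hb with rfl | rfl
    · exact absurd rfl hab.ne
    · exact absurd hab h13
    · exact absurd hab.symm h13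
    · exact absurd rfl hab.ne
  simp only [List.append_assoc, List.cons_append] at hch hnd hA
  obtain ⟨hq1, hq2, hq12⟩ := List.isChain_append.1 hch
  have hq3 := (List.isChain_append (l₁ := z :: q₂)).1 hq2
  simp only [List.isChain_cons_cons] at hq3
  have hnd' := hnd
  simp only [List.nodup_append, List.nodup_cons, List.mem_append, List.mem_cons,
    List.not_mem_nil, or_false, not_or, List.nodup_nil, not_false_eq_true, and_true] at hnd'
  obtain ⟨n1, ⟨⟨z1, z2, z3, z4⟩, n2, ⟨⟨e1, e2⟩, e3⟩, n3⟩, n4⟩ := hnd'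
  have hrev : q₂.reverse ++ [z] = (z :: q₂).reverse := by simp
  -- Starting from `x₁` and `x₃` of equal colour, run from `x₃` down `q₂` towards `z`, then up `q₁`
  -- to `z`, whose neighbour `x₂` is still free. Last comes `x₂`, which sees the colour of `x₁` and
  -- `x₃` twice.
  obtain ⟨c₁, hc₁, hp₁⟩ := extend_path hF q₂.reverse z _ _ h0 (by
      rw [hrev, List.isChain_reverse]
      exact hq3.1.imp fun a b h => h.symm) (by
      rw [hrev, List.nodup_reverse]
      exact List.nodup_cons.2 ⟨z1, n2⟩) (by
      intro x hx
      simp only [List.mem_append, List.mem_reverse, List.mem_singleton] at hx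
      simp only [Finset.mem_insert, Finset.mem_singleton, not_or]
      rcases hx with hx | rfl
      · exact ⟨n3 x hx _ (by simp), n3 x hx _ (by simp)⟩
      · exact ⟨z4, z2⟩)
  obtain ⟨c₂, hc₂⟩ := extend_path_closing hF (L := q₁ ++ [z]) (u := x₂) (p := x₁) (q := x₃) hp₁
    (by
      rw [List.append_assoc, List.isChain_append]
      refine ⟨hq1, by simpa using hz.symm, ?_⟩
      intro a ha b hb
      exact hq12 a ha b (by simpa using hb))
    (by
      rw [List.append_assoc, List.nodup_append]
      refine ⟨n1, by simpa using z3, fun a ha b hb => n4 a ha b ?_⟩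
      simp only [List.cons_append, List.nil_append, List.mem_cons, List.not_mem_nil,
        or_false] at hb
      tauto)
    (by
      intro x hx hx'
      simp only [List.mem_append, List.mem_singleton] at hx
      simp only [Finset.mem_union, Finset.mem_insert, Finset.mem_singleton, List.mem_toFinset,
        List.mem_reverse] at hx'
      rcases hx with (hx | rfl) | rfl
      · exact n4 x hx x (by tauto) rfl
      · tauto
      · rcases hx' with (h | h) | h
        · exact e3 h
        · exact e1 h.symm
        · exact n3 _ h _ (Or.inr (Or.inl rfl)) rfl)
    (by simp) (by simp) (Ne.symm e2) hq3.2.1.2.1 hq3.2.1.1.symm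
    (by rw [hc₁ _ (by simp), hc₁ _ (by simp)])
  refine ⟨c₂, ?_⟩
  convert hc₂ using 1
  rw [← hA]
  ext x; simp; tauto

end ProperOn

/-- **Brooks' theorem** for graphs of maximum degree at most three. -/
theorem SimpleGraph.colorable_three_of_cliqueFree_four {V : Type*} [Finite V] {F : SimpleGraph V}
    (hF : ∀ v, (F.neighborSet v).ncard ≤ 3) (hK : F.CliqueFree 4) :
    ∃ c : V → Fin 3, ∀ u w, F.Adj u w → c u ≠ c w := by
  classical
  have := Fintype.ofFinite V
  suffices h : ∀ A : Finset V, ∃ c : V → Fin 3, ProperOn F A c by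
    obtain ⟨c, hc⟩ := h Finset.univ
    exact ⟨c, fun u w h => hc u (Finset.mem_univ _) w (Finset.mem_univ _) h⟩
  intro A
  induction A using Finset.strongInduction with
  | H A ih =>
  by_contra hno
  -- A minimal uncolourable `A` is closed under adjacency, connected, and has all degrees equal to
  -- three.
  have hext : ∀ v ∈ A, (∃ n, F.Adj v n ∧ ∀ m ∈ A, F.Adj v m → m ≠ n) → False := by
    rintro v hv ⟨n, hvn, hn⟩
    obtain ⟨c, hc⟩ := ih _ (Finset.erase_ssubset hv)
    obtain ⟨t, ht⟩ := ProperOn.exists_color_avoiding_neighbors_except hF c hvn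
    have := hc.update_insert (Finset.notMem_erase v A) (t := t) (fun w hw hvw =>
      ht w hvw (hn w (Finset.mem_of_mem_erase hw) hvw))
    rw [Finset.insert_erase hv] at this
    exact hno ⟨_, this⟩
  have hcl : ∀ u ∈ A, ∀ w, F.Adj u w → w ∈ A := by
    intro v hv n hvn
    by_contra hn
    exact hext v hv ⟨n, hvn, fun m hm _ e => hn (e ▸ hm)⟩
  have hthree : ∀ v ∈ A, 2 < (F.neighborSet v).ncard := by
    intro v hv
    by_contra hlt
    obtain ⟨c, hc⟩ := ih _ (Finset.erase_ssubset hv)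
    have h1 : c '' (F.neighborSet v) ≠ Set.univ := by
      intro h
      have h2 := Set.ncard_image_le (f := c) (Set.toFinite (F.neighborSet v))
      rw [h, Set.ncard_univ, Nat.card_eq_fintype_card, Fintype.card_fin] at h2
      omega
    obtain ⟨t, ht⟩ := (Set.ne_univ_iff_exists_notMem _).1 h1
    have := hc.update_insert (Finset.notMem_erase v A) (t := t) (fun w hw hvw e =>
      ht ⟨w, hvw, e⟩)
    rw [Finset.insert_erase hv] at this
    exact hno ⟨_, this⟩
  have hconn : ∀ B ⊆ A, B.Nonempty → (∀ u ∈ B, ∀ w, F.Adj u w → w ∈ B) → B = A := by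
    intro B hBA hB hBcl
    by_contra hne
    obtain ⟨c, hc⟩ := ih (A \ B) (Finset.sdiff_ssubset hBA hB)
    obtain ⟨c', hc'⟩ := ih B (Finset.ssubset_iff_subset_ne.2 ⟨hBA, hne⟩)
    have := hc.of_closed_union hc' hBcl
    rw [Finset.sdiff_union_of_subset hBA] at this
    exact hno ⟨_, this⟩
  obtain ⟨x₂, hx₂⟩ : A.Nonempty := by
    rw [Finset.nonempty_iff_ne_empty]
    rintro rfl
    exact hno ⟨fun _ => 0, by intro u hu; simp at hu⟩
  obtain ⟨a, b, d, ha, hb, hd, hab, had, hbd⟩ :=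
    (Set.two_lt_ncard_iff (Set.toFinite _)).1 (hthree x₂ hx₂)
  rw [SimpleGraph.mem_neighborSet] at ha hb hd
  -- Some two neighbours of `x₂` are non-adjacent, since otherwise `x₂` and its neighbours form a
  -- 4-clique.
  obtain ⟨x₁, x₃, z, h1, h3, hz, h13, h1z, h3z, hn13⟩ : ∃ x₁ x₃ z, F.Adj x₂ x₁ ∧ F.Adj x₂ x₃ ∧
      F.Adj x₂ z ∧ x₁ ≠ x₃ ∧ x₁ ≠ z ∧ x₃ ≠ z ∧ ¬ F.Adj x₁ x₃ := by
    by_cases e1 : F.Adj a b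
    · by_cases e2 : F.Adj a d
      · by_cases e3 : F.Adj b d
        · refine absurd ?_ (hK {x₂, a, b, d})
          refine SimpleGraph.IsNClique.insert (SimpleGraph.is3Clique_triple_iff.2 ⟨e1, e2, e3⟩) ?_
          simp [ha, hb, hd]
        · exact ⟨b, d, a, hb, hd, ha, hbd, hab.symm, had.symm, e3⟩
      · exact ⟨a, d, b, ha, hd, hb, had, hab, hbd.symm, e2⟩
    · exact ⟨a, b, d, ha, hb, hd, hab, had, hbd, e1⟩
  obtain ⟨p, hch, hnd, hlA, hmax⟩ := ProperOn.exists_maximal_path (F := F) (A := A)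
    (s := [x₃, x₂, x₁]) (by simp [h1, h3.symm]) (by simp [h1.ne, h3.ne.symm, h13.symm])
    (by simp [hx₂, hcl x₂ hx₂ _ h1, hcl x₂ hx₂ _ h3])
  obtain ⟨h, k, T, hl⟩ : ∃ h k T, p ++ [x₃, x₂, x₁] = h :: k :: T := by
    match p with
    | [] => exact ⟨_, _, _, rfl⟩
    | [y] => exact ⟨_, _, _, rfl⟩
    | y :: y' :: p => exact ⟨_, _, _, rfl⟩
  have hhA : h ∈ A := hlA h (by simp [hl])
  have hnb : ∀ w, F.Adj h w → w ∈ p ++ [x₃, x₂, x₁] := by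
    intro w hw
    refine hmax w (hcl h hhA w hw) ?_
    rw [hl] at hch ⊢
    exact List.isChain_cons_cons.2 ⟨hw.symm, hch⟩
  have hhk : F.Adj h k := by
    rw [hl] at hch
    exact (List.isChain_cons_cons.1 hch).1
  -- By maximality all neighbours of the head `h` lie on the path. The last of them, `e`, closes a
  -- cycle containing them all.
  obtain ⟨C, e, D, hCD, he, hD⟩ := List.exists_eq_append_last (p := fun x => F.Adj h x)
    (l := p ++ [x₃, x₂, x₁]) ⟨k, by simp [hl], hhk⟩
  have hCD' : p ++ [x₃, x₂, x₁] = (C ++ [e]) ++ D := by simp [hCD]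
  have hhead : ∀ h' ∈ (C ++ [e]).head?, h' = h := by
    cases C with
    | nil =>
      rw [hl] at hCD
      simp only [List.nil_append, List.cons.injEq] at hCD
      exact absurd hCD.1 he.ne
    | cons y C =>
      rw [hl] at hCD
      simp only [List.cons_append, List.cons.injEq] at hCD
      intro h' hh'
      simpa [hCD.1, eq_comm] using hh'
  have hsubA : ∀ x ∈ C ++ [e], x ∈ A := fun x hx =>
    hlA x (by rw [hCD']; exact List.mem_append_left _ hx)
  by_cases hout : ∃ x ∈ C ++ [e], ∃ y, F.Adj x y ∧ y ∉ C ++ [e]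
  · refine hno (ProperOn.exists_of_cycle hF hcl (C := C ++ [e]) ?_ ?_ hsubA ?_ ?_ hout (ih _ ?_))
    · rw [hCD'] at hch
      exact (List.isChain_append.1 hch).1
    · rw [hCD'] at hnd
      exact (List.nodup_append.1 hnd).1
    · intro x hx y hy
      rw [hhead x hx]
      have : y = e := by simpa [eq_comm] using hy
      rwa [this]
    · intro h' hh' w hw
      rw [hhead h' hh'] at hw
      have h5 := hnb w hw
      rw [hCD', List.mem_append] at h5
      exact h5.resolve_right fun h6 => hD w h6 hw
    · refine Finset.sdiff_ssubset (fun x hx => hsubA x (List.mem_toFinset.1 hx)) ⟨e, by simp⟩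
  -- No edge leaves the cycle, so it fills `A` by connectedness and the path is Hamiltonian.
  · push Not at hout
    have hCA : (C ++ [e]).toFinset = A := hconn _
      (fun x hx => hsubA x (List.mem_toFinset.1 hx)) ⟨e, by simp⟩
      (fun u hu w huw => List.mem_toFinset.2 (hout u (List.mem_toFinset.1 hu) w huw))
    have hlA' : (p ++ [x₃, x₂, x₁]).toFinset = A := by
      refine le_antisymm (fun x hx => hlA x (List.mem_toFinset.1 hx)) ?_
      rw [← hCA, hCD']
      intro x hx
      simp only [List.mem_toFinset] at hx ⊢
      exact List.mem_append_left _ hx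
    refine hno (ProperOn.exists_of_hamiltonian hF hch hnd hlA' hn13 hz ?_)
    have hzA := hcl x₂ hx₂ z hz
    rw [← hlA', List.mem_toFinset] at hzA
    simpa [h3z.symm, hz.ne.symm, h1z.symm] using hzA

/-! ### Petersen's theorem for subcubic graphs, via Tutte's theorem -/

/-- The edges of `G` that leave `C`, directed away from `C`. -/
def SimpleGraph.outEdges {V : Type*} (G : SimpleGraph V) (C : Set V) : Set (V × V) :=
  {p | p.1 ∈ C ∧ p.2 ∉ C ∧ G.Adj p.1 p.2}

namespace SimpleGraph

variable {V : Type*} [Finite V] {G : SimpleGraph V}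

theorem ncard_adj_pairs_eq_sum (G : SimpleGraph V) (C : Finset V) :
    {p : V × V | p.1 ∈ C ∧ G.Adj p.1 p.2}.ncard = ∑ v ∈ C, (G.neighborSet v).ncard := by
  classical
  have := Fintype.ofFinite V
  rw [Set.ncard_eq_toFinset_card', Finset.card_eq_sum_card_fiberwise (f := Prod.fst) (t := C)]
  · refine Finset.sum_congr rfl fun v hv => ?_
    rw [Set.ncard_eq_toFinset_card']
    refine Finset.card_bij (fun p _ => p.2) ?_ ?_ ?_
    · rintro ⟨a, b⟩ h
      simp only [Finset.mem_filter, Set.mem_toFinset, Set.mem_ofPred_eq] at h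
      simpa [← h.2] using h.1.2
    · rintro ⟨a, b⟩ h ⟨a', b'⟩ h' e
      simp only [Finset.mem_filter] at h h' e
      rw [h.2, h'.2, e]
    · intro b hb
      exact ⟨(v, b), by simpa [hv] using hb, rfl⟩
  · intro p hp
    simp only [Set.coe_toFinset, Set.mem_ofPred_eq] at hp
    exact hp.1

theorem even_ncard_adj_pairs_within (G : SimpleGraph V) (C : Set V) :
    Even {p : V × V | p.1 ∈ C ∧ p.2 ∈ C ∧ G.Adj p.1 p.2}.ncard := by
  classical
  have := Fintype.ofFinite V
  rw [Set.ncard_eq_toFinset_card', ← ZMod.natCast_eq_zero_iff_even, Finset.card_eq_sum_ones,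
    Nat.cast_sum]
  refine Finset.sum_involution (fun p _ => (p.2, p.1)) ?_ ?_ ?_ ?_
  · intro p _
    decide
  · rintro ⟨a, b⟩ hp _ e
    simp only [Set.mem_toFinset, Set.mem_ofPred_eq] at hp
    exact hp.2.2.ne (Prod.ext_iff.1 e).2
  · rintro ⟨a, b⟩ hp
    simp only [Set.mem_toFinset, Set.mem_ofPred_eq] at hp ⊢
    exact ⟨hp.2.1, hp.1, hp.2.2.symm⟩
  · intro p _
    rfl

/-- The degree sum over `C` is `3 * |C|`, which is odd, and edges inside `C` contribute an even
amount to it. -/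
theorem odd_ncard_outEdges {C : Set V} (hC : Odd C.ncard)
    (h3 : ∀ v ∈ C, (G.neighborSet v).ncard = 3) : Odd (G.outEdges C).ncard := by
  classical
  have := Fintype.ofFinite V
  have h1 := G.ncard_adj_pairs_eq_sum C.toFinset
  rw [Finset.sum_congr rfl fun v hv => h3 v (by simpa using hv), Finset.sum_const,
    ← Set.ncard_eq_toFinset_card'] at h1
  have h2 := G.even_ncard_adj_pairs_within C
  have h4 : {p : V × V | p.1 ∈ C.toFinset ∧ G.Adj p.1 p.2} =
      G.outEdges C ∪ {p : V × V | p.1 ∈ C ∧ p.2 ∈ C ∧ G.Adj p.1 p.2} := by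
    ext p
    simp only [outEdges, Set.mem_toFinset, Set.mem_ofPred_eq, Set.mem_union]
    tauto
  rw [h4, Set.ncard_union_eq (Set.disjoint_left.2 fun p hp hp' => hp.2.1 hp'.2.1)] at h1
  grind

/-- A version of **Petersen's theorem**: a subcubic graph of even order in which no edge is a cut
has a matching that covers all vertices of degree three. -/
theorem exists_matching_of_no_bridge (hG : ∀ v, (G.neighborSet v).ncard ≤ 3)
    (hV : Even (Nat.card V)) (hcut : ∀ C : Set V, (G.outEdges C).ncard ≠ 1) :
    ∃ m : V → V, (∀ v, m (m v) = v) ∧ (∀ v, m v ≠ v → G.Adj v (m v)) ∧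
      ∀ v, (G.neighborSet v).ncard = 3 → m v ≠ v := by
  classical
  have := Fintype.ofFinite V
  let low : V → Prop := fun v => (G.neighborSet v).ncard ≠ 3
  -- Joining all vertices of degree below three lets them be matched among themselves; such added
  -- pairs are dropped afterwards. It also puts all those outside a Tutte set `S` into a single
  -- component.
  let H : SimpleGraph V :=
    { Adj := fun u v => G.Adj u v ∨ (u ≠ v ∧ low u ∧ low v)
      symm := ⟨fun u v h => h.imp (fun h => h.symm) fun h => ⟨h.1.symm, h.2.2, h.2.1⟩⟩
      loopless := ⟨fun u h => h.elim (fun h => h.ne rfl) fun h => h.1 rfl⟩ }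
  by_cases hM : ∃ M : Subgraph H, M.IsPerfectMatching
  · obtain ⟨M, hM⟩ := hM
    rw [Subgraph.isPerfectMatching_iff] at hM
    choose f hf hf' using hM
    have hff : ∀ v, f (f v) = v := fun v => (hf' (f v) v (hf v).symm).symm
    refine ⟨fun v => if G.Adj v (f v) then f v else v, ?_, ?_, ?_⟩
    · intro v
      by_cases h : G.Adj v (f v)
      · simp [h, hff, h.symm]
      · simp [h]
    · intro v
      by_cases h : G.Adj v (f v)
      · simp [h]
      · simp [h]
    · intro v hv
      have h : G.Adj v (f v) := (hf v).adj_sub.resolve_right fun h => h.2.1 hv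
      simpa [h] using h.ne.symm
  · exfalso
    rw [tutte] at hM
    push Not at hM
    obtain ⟨S, hS⟩ := hM
    unfold IsTutteViolator at hS
    set K := ((⊤ : H.Subgraph).deleteVerts S).coe with hK
    have hadj : ∀ a b, K.Adj a b ↔ H.Adj a.1 b.1 := by
      intro a b
      have ha := a.2.2
      have hb := b.2.2
      simp [hK, ha, hb]
    let U : K.ConnectedComponent → Set V := fun c => Subtype.val '' c.supp
    have hUS : ∀ c, ∀ u ∈ U c, u ∉ S := by
      rintro c _ ⟨u, -, rfl⟩
      exact u.2.2
    have hUcl : ∀ c, ∀ u ∈ U c, ∀ w, w ∉ S → H.Adj u w → w ∈ U c := by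
      rintro c _ ⟨u, hu, rfl⟩ w hw huw
      refine ⟨⟨w, trivial, hw⟩, ?_, rfl⟩
      exact ConnectedComponent.mem_supp_of_adj_mem_supp c hu ((hadj _ _).2 huw)
    have hUdisj : ∀ c d, ∀ u, u ∈ U c → u ∈ U d → c = d := by
      rintro c d _ ⟨u, hu, rfl⟩ ⟨u', hu', e⟩
      rw [Subtype.ext e] at hu'
      rw [ConnectedComponent.mem_supp_iff] at hu hu'
      rw [← hu, hu']
    have hUcard : ∀ c, (U c).ncard = c.supp.ncard := fun c =>
      Set.ncard_image_of_injective _ Subtype.val_injective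
    let Oh : Set K.ConnectedComponent := {c | c ∈ K.oddComponents ∧ ∀ u ∈ U c, ¬ low u}
    let Ol : Set K.ConnectedComponent := {c | c ∈ K.oddComponents ∧ ∃ u ∈ U c, low u}
    have hsplit : K.oddComponents ⊆ Oh ∪ Ol := by
      intro c hc
      by_cases h : ∃ u ∈ U c, low u
      · exact Or.inr ⟨hc, h⟩
      · push Not at h
        exact Or.inl ⟨hc, fun u hu => not_not.2 (not_not.1 (h u hu))⟩
    have hOl : Ol.ncard ≤ 1 := by
      rw [Set.ncard_le_one_iff]
      rintro c d ⟨-, u, hu, hul⟩ ⟨-, w, hw, hwl⟩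
      by_cases e : u = w
      · exact hUdisj c d u hu (e ▸ hw)
      · exact hUdisj c d w (hUcl c u hu w (hUS d w hw) (Or.inr ⟨e, hul, hwl⟩)) hw
    have hthree : ∀ c ∈ Oh, 3 ≤ (G.outEdges (U c)).ncard := by
      rintro c ⟨hc, hlow⟩
      have h1 := odd_ncard_outEdges (G := G) (C := U c) (by rw [hUcard]; exact hc)
        (fun v hv => not_not.1 (hlow v hv))
      have h2 := hcut (U c)
      obtain ⟨k, hk⟩ := h1
      omega
    -- Each odd component without low vertices sends at least three edges, all of them into `S`, and
    -- `S` receives at most `3 * |S|`.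
    have hOh : Oh.ncard * 3 ≤ S.ncard * 3 := by
      calc Oh.ncard * 3 = ∑ c ∈ Oh.toFinset, 3 := by
            rw [Finset.sum_const, Set.ncard_eq_toFinset_card', smul_eq_mul]
        _ ≤ ∑ c ∈ Oh.toFinset, ((G.outEdges (U c)).toFinset.image Prod.swap).card := by
            refine Finset.sum_le_sum fun c hc => ?_
            rw [Finset.card_image_of_injective _ Prod.swap_injective,
              ← Set.ncard_eq_toFinset_card']
            exact hthree c (by simpa using hc)
        _ = (Oh.toFinset.biUnion fun c =>
              (G.outEdges (U c)).toFinset.image Prod.swap).card := by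
            refine (Finset.card_biUnion ?_).symm
            intro c _ d _ hcd
            refine Finset.disjoint_left.2 fun p hp hp' => hcd ?_
            obtain ⟨q, hq, rfl⟩ := Finset.mem_image.1 hp
            obtain ⟨q', hq', e⟩ := Finset.mem_image.1 hp'
            rw [Prod.swap_injective e] at hq'
            exact hUdisj c d q.1 (by simpa using (Set.mem_toFinset.1 hq).1)
              (by simpa using (Set.mem_toFinset.1 hq').1)
        _ ≤ {p : V × V | p.1 ∈ S.toFinset ∧ G.Adj p.1 p.2}.toFinset.card := by
            refine Finset.card_le_card fun p hp => ?_
            obtain ⟨c, -, hp⟩ := Finset.mem_biUnion.1 hp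
            obtain ⟨⟨a, b⟩, hq, rfl⟩ := Finset.mem_image.1 hp
            obtain ⟨h1, h2, h3⟩ := Set.mem_toFinset.1 hq
            simp only [Set.mem_toFinset, Set.mem_ofPred_eq, Prod.swap]
            refine ⟨?_, h3.symm⟩
            by_contra hb
            exact h2 (hUcl c a h1 b hb (Or.inl h3))
        _ = ∑ v ∈ S.toFinset, (G.neighborSet v).ncard := by
            rw [← G.ncard_adj_pairs_eq_sum, ← Set.ncard_eq_toFinset_card']
        _ ≤ ∑ v ∈ S.toFinset, 3 := Finset.sum_le_sum fun v _ => hG v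
        _ = S.ncard * 3 := by
            rw [Finset.sum_const, Set.ncard_eq_toFinset_card', smul_eq_mul]
    have hle : K.oddComponents.ncard ≤ Oh.ncard + Ol.ncard :=
      (Set.ncard_le_ncard hsplit (Set.toFinite _)).trans (Set.ncard_union_le _ _)
    have hpar := K.odd_ncard_oddComponents
    have hcard : Nat.card ((⊤ : H.Subgraph).deleteVerts S).verts + S.ncard = Nat.card V := by
      have h1 : ((⊤ : H.Subgraph).deleteVerts S).verts = Sᶜ := by
        ext v; simp
      rw [h1, Nat.card_coe_set_eq, add_comm, Set.ncard_add_ncard_compl]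
    -- The violator has more than `|S|` odd components, and at most `|S| + 1` are possible. Exactly
    -- `|S| + 1` would make the order of `G` odd.
    have hS' : K.oddComponents.ncard = S.ncard + 1 := by omega
    rw [hS', Nat.odd_iff, Nat.odd_iff] at hpar
    rw [Nat.even_iff] at hV
    omega

end SimpleGraph

/-! ### Covering matchings and the pairing graph -/

/-- A matching of a subcubic graph that covers all vertices of degree three, given as the
involution that swaps matched vertices. -/
structure SimpleGraph.IsCoveringMatching {V : Type*} (G : SimpleGraph V) (m : V → V) : Prop where
  ncard_le : ∀ v, (G.neighborSet v).ncard ≤ 3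
  invol : ∀ v, m (m v) = v
  adj : ∀ v, m v ≠ v → G.Adj v (m v)
  covers : ∀ v, (G.neighborSet v).ncard = 3 → m v ≠ v

/-- The neighbours of `v` outside the matching. -/
def SimpleGraph.unmatchedNbrs {V : Type*} (G : SimpleGraph V) (m : V → V) (v : V) : Set V :=
  {u | G.Adj v u ∧ m v ≠ u}

/-- Two vertices are adjacent in the pairing graph if they are matched, or if they are the two
unmatched neighbours of a common vertex. -/
def SimpleGraph.pairingGraph {V : Type*} (G : SimpleGraph V) (m : V → V) : SimpleGraph V where
  Adj u w := u ≠ w ∧ ((m u = w ∨ m w = u) ∨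
    ∃ v, u ∈ G.unmatchedNbrs m v ∧ w ∈ G.unmatchedNbrs m v)
  symm := ⟨fun _ _ h => ⟨h.1.symm, h.2.imp Or.symm fun ⟨v, h⟩ => ⟨v, h.symm⟩⟩⟩
  loopless := ⟨fun _ h => h.1 rfl⟩

namespace SimpleGraph.IsCoveringMatching

variable {V : Type*} {G : SimpleGraph V} {m : V → V}

theorem mem_unmatchedNbrs_comm (h : G.IsCoveringMatching m) {u v : V} :
    u ∈ G.unmatchedNbrs m v ↔ v ∈ G.unmatchedNbrs m u := by
  have key : ∀ u v, u ∈ G.unmatchedNbrs m v → v ∈ G.unmatchedNbrs m u := fun u v hu =>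
    ⟨hu.1.symm, fun e => hu.2 (by rw [← e, h.invol])⟩
  exact ⟨key u v, key v u⟩

theorem eq_mate_comm (h : G.IsCoveringMatching m) {u w : V} : m u = w ↔ m w = u :=
  ⟨fun e => by rw [← e, h.invol], fun e => by rw [← e, h.invol]⟩

theorem pairingGraph_adj_iff (h : G.IsCoveringMatching m) {u w : V} :
    (G.pairingGraph m).Adj u w ↔ u ≠ w ∧ (m u = w ∨
      ∃ v, u ∈ G.unmatchedNbrs m v ∧ w ∈ G.unmatchedNbrs m v) := by
  simp only [pairingGraph, h.eq_mate_comm (u := w), or_self]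

theorem pairingGraph_adj_mate (h : G.IsCoveringMatching m) {u : V} (hu : m u ≠ u) :
    (G.pairingGraph m).Adj u (m u) :=
  h.pairingGraph_adj_iff.2 ⟨hu.symm, Or.inl rfl⟩

theorem pairingGraph_adj_of_mem (h : G.IsCoveringMatching m) {u v w : V} (hne : u ≠ w)
    (hu : u ∈ G.unmatchedNbrs m v) (hw : w ∈ G.unmatchedNbrs m v) :
    (G.pairingGraph m).Adj u w :=
  h.pairingGraph_adj_iff.2 ⟨hne, Or.inr ⟨v, hu, hw⟩⟩

variable [Finite V]

theorem ncard_unmatchedNbrs_le (h : G.IsCoveringMatching m) (v : V) :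
    (G.unmatchedNbrs m v).ncard ≤ 2 := by
  by_cases hv : m v = v
  · have h1 : G.unmatchedNbrs m v ⊆ G.neighborSet v := fun u hu => hu.1
    have h2 := Set.ncard_le_ncard h1 (Set.toFinite _)
    have h3 := h.ncard_le v
    have h4 := mt (h.covers v) (not_not.2 hv)
    omega
  · have h1 : G.unmatchedNbrs m v = G.neighborSet v \ {m v} := by
      ext u
      simp [unmatchedNbrs, eq_comm]
    have h2 := Set.ncard_sdiff_singleton_add_one (s := G.neighborSet v) (a := m v) (h.adj v hv)
      (Set.toFinite _)
    have h3 := h.ncard_le v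
    rw [h1]
    omega

theorem eq_of_mem_unmatchedNbrs (h : G.IsCoveringMatching m) {v a b d : V}
    (ha : a ∈ G.unmatchedNbrs m v) (hb : b ∈ G.unmatchedNbrs m v)
    (hd : d ∈ G.unmatchedNbrs m v) (hab : a ≠ b) : d = a ∨ d = b := by
  by_contra! hcon
  have := (Set.two_lt_ncard_iff (Set.toFinite (G.unmatchedNbrs m v))).2
    ⟨a, b, d, ha, hb, hd, hab, hcon.1.symm, hcon.2.symm⟩
  have := h.ncard_unmatchedNbrs_le v
  omega

/-- An unmatched neighbour `v` of `u` has at most one further unmatched neighbour, `g v`. So `u`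
gets at most one edge from each of its at most two unmatched neighbours, besides the edge to its
mate. -/
theorem neighborSet_pairingGraph_subset (h : G.IsCoveringMatching m) (u : V) :
    ∃ g : V → V, (∀ v w, v ∈ G.unmatchedNbrs m u → w ∈ G.unmatchedNbrs m v → w ≠ u → w = g v) ∧
      (G.pairingGraph m).neighborSet u ⊆ insert (m u) (g '' G.unmatchedNbrs m u) := by
  have hg : ∀ v, ∃ w, ∀ w', v ∈ G.unmatchedNbrs m u → w' ∈ G.unmatchedNbrs m v → w' ≠ u →
      w' = w := by
    intro v
    by_cases hv : ∃ w ∈ G.unmatchedNbrs m v, w ≠ u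
    · obtain ⟨w, hw, hwu⟩ := hv
      refine ⟨w, fun w' hv hw' hne => ?_⟩
      exact (h.eq_of_mem_unmatchedNbrs (h.mem_unmatchedNbrs_comm.1 hv) hw hw' hwu.symm).resolve_left
        hne
    · push Not at hv
      exact ⟨u, fun w' _ hw' hne => absurd (hv w' hw') hne⟩
  choose g hg using hg
  refine ⟨g, fun v w => hg v w, fun w hw => ?_⟩
  obtain ⟨hne, hw | ⟨v, hu, hw⟩⟩ := h.pairingGraph_adj_iff.1 hw
  · exact Or.inl hw.symm
  · have hv := h.mem_unmatchedNbrs_comm.1 hu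
    exact Or.inr ⟨v, hv, (hg v w hv hw hne.symm).symm⟩

theorem ncard_neighborSet_pairingGraph_le (h : G.IsCoveringMatching m) (u : V) :
    ((G.pairingGraph m).neighborSet u).ncard ≤ 3 := by
  obtain ⟨g, -, hg⟩ := h.neighborSet_pairingGraph_subset u
  have h1 := Set.ncard_le_ncard hg (Set.toFinite _)
  have h2 := Set.ncard_insert_le (m u) (g '' G.unmatchedNbrs m u)
  have h3 := Set.ncard_image_le (f := g) (Set.toFinite (G.unmatchedNbrs m u))
  have h4 := h.ncard_unmatchedNbrs_le u
  omega

/-! ### 4-cliques of the pairing graph -/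

section Clique

variable {Q : Finset V}

/-- Degrees are at most three, so a 4-clique uses up all edges at its vertices and is a whole
component. Every bound on neighbours is then attained, which gives the rigidity used below. -/
theorem neighborSet_eq_of_clique (h : G.IsCoveringMatching m)
    (hQ : (G.pairingGraph m).IsNClique 4 Q) {u : V} (hu : u ∈ Q) :
    (Q : Set V) \ {u} = (G.pairingGraph m).neighborSet u := by
  refine Set.eq_of_subset_of_ncard_le (fun w hw => hQ.1 hu hw.1 (Ne.symm hw.2)) ?_
    (Set.toFinite _)
  have h1 := Set.ncard_sdiff_singleton_add_one (s := (Q : Set V)) (a := u) hu (Set.toFinite _)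
  rw [Set.ncard_coe_finset, hQ.2] at h1
  have := h.ncard_neighborSet_pairingGraph_le u
  omega

theorem mem_of_adj_of_clique (h : G.IsCoveringMatching m)
    (hQ : (G.pairingGraph m).IsNClique 4 Q) {u w : V} (hu : u ∈ Q)
    (huw : (G.pairingGraph m).Adj u w) : w ∈ Q := by
  have : w ∈ (Q : Set V) \ {u} := by rwa [h.neighborSet_eq_of_clique hQ hu]
  exact this.1

theorem two_lt_ncard_of_clique (h : G.IsCoveringMatching m)
    (hQ : (G.pairingGraph m).IsNClique 4 Q) {u : V} (hu : u ∈ Q) :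
    2 < ((G.pairingGraph m).neighborSet u).ncard := by
  have h1 := Set.ncard_sdiff_singleton_add_one (s := (Q : Set V)) (a := u) hu (Set.toFinite _)
  rw [Set.ncard_coe_finset, hQ.2, h.neighborSet_eq_of_clique hQ hu] at h1
  omega

theorem mate_ne_of_clique (h : G.IsCoveringMatching m)
    (hQ : (G.pairingGraph m).IsNClique 4 Q) {u : V} (hu : u ∈ Q) : m u ≠ u := by
  intro e
  obtain ⟨g, -, hg⟩ := h.neighborSet_pairingGraph_subset u
  have h1 : (G.pairingGraph m).neighborSet u ⊆ g '' G.unmatchedNbrs m u := by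
    intro w hw
    refine (hg hw).resolve_left fun e' => ?_
    exact hw.1 (by rw [e', e])
  have h2 := Set.ncard_le_ncard h1 (Set.toFinite _)
  have h3 := Set.ncard_image_le (f := g) (Set.toFinite (G.unmatchedNbrs m u))
  have h4 := h.ncard_unmatchedNbrs_le u
  have h5 := h.two_lt_ncard_of_clique hQ hu
  omega

/-- Otherwise the edge to the mate coincides with the one obtained through `v`, and `u` has degree
at most two. -/
theorem mate_notMem_of_clique (h : G.IsCoveringMatching m)
    (hQ : (G.pairingGraph m).IsNClique 4 Q) {u v : V} (hu : u ∈ Q)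
    (hv : v ∈ G.unmatchedNbrs m u) : m u ∉ G.unmatchedNbrs m v := by
  intro hw
  obtain ⟨g, hg', hg⟩ := h.neighborSet_pairingGraph_subset u
  have h1 : (G.pairingGraph m).neighborSet u ⊆ g '' G.unmatchedNbrs m u := by
    intro w hw'
    rcases hg hw' with rfl | h6
    · exact ⟨v, hv, (hg' v _ hv hw (h.mate_ne_of_clique hQ hu)).symm⟩
    · exact h6
  have h2 := Set.ncard_le_ncard h1 (Set.toFinite _)
  have h3 := Set.ncard_image_le (f := g) (Set.toFinite (G.unmatchedNbrs m u))
  have h4 := h.ncard_unmatchedNbrs_le u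
  have h5 := h.two_lt_ncard_of_clique hQ hu
  omega

theorem mate_mem_of_clique (h : G.IsCoveringMatching m)
    (hQ : (G.pairingGraph m).IsNClique 4 Q) {u : V} (hu : u ∈ Q) : m u ∈ Q :=
  h.mem_of_adj_of_clique hQ hu (h.pairingGraph_adj_mate (h.mate_ne_of_clique hQ hu))

end Clique

/-- `Q` is a 4-clique of the pairing graph that consists of `a`, `b` and their mates, and `x` is the
only vertex with unmatched neighbours `a` and `b`. -/
structure IsQuad (G : SimpleGraph V) (m : V → V) (Q : Finset V) (a b x : V) : Prop where
  clique : (G.pairingGraph m).IsNClique 4 Q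
  mem_iff : ∀ v, v ∈ Q ↔ v = a ∨ v = m a ∨ v = b ∨ v = m b
  ne : a ≠ b
  ne_mate : b ≠ m a
  left : a ∈ G.unmatchedNbrs m x
  right : b ∈ G.unmatchedNbrs m x
  unique : ∀ v, a ∈ G.unmatchedNbrs m v → b ∈ G.unmatchedNbrs m v → v = x

theorem isQuad_of_clique (h : G.IsCoveringMatching m) {Q : Finset V}
    (hQ : (G.pairingGraph m).IsNClique 4 Q) {a b x : V} (ha : a ∈ Q) (hab : a ≠ b)
    (hbm : b ≠ m a) (hax : a ∈ G.unmatchedNbrs m x) (hbx : b ∈ G.unmatchedNbrs m x) :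
    IsQuad G m Q a b x := by
  classical
  have hb : b ∈ Q := h.mem_of_adj_of_clique hQ ha (h.pairingGraph_adj_of_mem hab hax hbx)
  have hma := h.mate_ne_of_clique hQ ha
  have hmb := h.mate_ne_of_clique hQ hb
  have hamb : a ≠ m b := fun e => hbm (h.eq_mate_comm.1 e.symm).symm
  have hmm : m a ≠ m b := fun e => hab (by rw [← h.invol a, e, h.invol])
  refine ⟨hQ, ?_, hab, hbm, hax, hbx, ?_⟩
  · have h1 : ({a, m a, b, m b} : Finset V) = Q := by
      refine Finset.eq_of_subset_of_card_le ?_ ?_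
      · intro v hv
        simp only [Finset.mem_insert, Finset.mem_singleton] at hv
        rcases hv with rfl | rfl | rfl | rfl
        · exact ha
        · exact h.mate_mem_of_clique hQ ha
        · exact hb
        · exact h.mate_mem_of_clique hQ hb
      · rw [hQ.2]
        rw [Finset.card_insert_of_notMem, Finset.card_insert_of_notMem, Finset.card_pair hmb.symm]
        · simp [hbm.symm, hmm]
        · simp [hma.symm, hab, hamb]
    intro v
    rw [← h1]
    simp
  · intro v hav hbv
    by_contra hvx
    -- The edge from `a` to `m b` comes from a common vertex `w`. As `v` and `x` exhaust the
    -- unmatched neighbours of `a`, `w` is one of them and has three unmatched neighbours `a`, `b`,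
    -- `m b`.
    have h2 := hQ.1 ha (h.mate_mem_of_clique hQ hb) hamb
    obtain ⟨-, h3 | ⟨w, haw, hbw⟩⟩ := h.pairingGraph_adj_iff.1 h2
    · exact hmm h3
    · have h4 := h.eq_of_mem_unmatchedNbrs (h.mem_unmatchedNbrs_comm.1 hav)
        (h.mem_unmatchedNbrs_comm.1 hax) (h.mem_unmatchedNbrs_comm.1 haw) hvx
      have h5 : b ∈ G.unmatchedNbrs m w := by rcases h4 with rfl | rfl <;> assumption
      rcases h.eq_of_mem_unmatchedNbrs haw h5 hbw hab with h6 | h6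
      · exact hamb h6.symm
      · exact hmb h6

/-! ### Good colourings and their extension to quadruples -/

/-- A colouring of `A` in which matched vertices have different colours, and the two unmatched
neighbours of a vertex `v` have different colours unless their common colour is used neither at `v`
nor at its mate. -/
def GoodOn (G : SimpleGraph V) (m : V → V) (A : Set V) (c : V → Fin 3) : Prop :=
  (∀ u ∈ A, m u ≠ u → c u ≠ c (m u)) ∧
  ∀ v, ∀ p ∈ G.unmatchedNbrs m v, ∀ q ∈ G.unmatchedNbrs m v, p ≠ q → p ∈ A → q ∈ A → c p = c q →
    v ∈ A ∧ c v ≠ c p ∧ c (m v) ≠ c p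

/-- `A` is a union of components of `F`. -/
def Closed (F : SimpleGraph V) (A : Set V) : Prop := ∀ u ∈ A, ∀ w, F.Adj u w → w ∈ A

omit [Finite V] in
theorem mate_mem_of_closed (h : G.IsCoveringMatching m) {A : Set V}
    (hA : Closed (G.pairingGraph m) A) {u : V} (hu : u ∈ A) : m u ∈ A := by
  by_cases e : m u = u
  · rwa [e]
  · exact hA u hu _ (h.pairingGraph_adj_mate e)

-- No edge of the pairing graph leaves `A`, so every pair to be checked lies inside `A` or avoids
-- it, and the old colouring settles the first kind.
omit [Finite V] in
theorem GoodOn.union (h : G.IsCoveringMatching m) {A B : Set V} {c c' : V → Fin 3}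
    (hA : Closed (G.pairingGraph m) A)
    (hc : GoodOn G m A c) (hcc : ∀ v ∈ A, c' v = c v) (h1 : ∀ u ∈ B, m u ≠ u → c' u ≠ c' (m u))
    (h2 : ∀ v, ∀ p ∈ G.unmatchedNbrs m v, ∀ q ∈ G.unmatchedNbrs m v, p ≠ q → p ∈ B → q ∈ B →
      c' p = c' q → v ∈ A ∪ B ∧ c' v ≠ c' p ∧ c' (m v) ≠ c' p) :
    GoodOn G m (A ∪ B) c' := by
  constructor
  · rintro u (hu | hu) hm
    · rw [hcc u hu, hcc _ (h.mate_mem_of_closed hA hu)]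
      exact hc.1 u hu hm
    · exact h1 u hu hm
  · intro v p hp q hq hpq hpA hqA e
    have hadj := h.pairingGraph_adj_of_mem hpq hp hq
    by_cases hpA' : p ∈ A
    · have hqA' := hA p hpA' q hadj
      rw [hcc p hpA', hcc q hqA'] at e
      obtain ⟨h3, h4, h5⟩ := hc.2 v p hp q hq hpq hpA' hqA' e
      rw [hcc v h3, hcc p hpA', hcc _ (h.mate_mem_of_closed hA h3)]
      exact ⟨Or.inl h3, h4, h5⟩
    · have hqA' : q ∉ A := fun hq' => hpA' (hA q hq' p hadj.symm)
      exact h2 v p hp q hq hpq (hpA.resolve_left hpA') (hqA.resolve_left hqA') e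

end SimpleGraph.IsCoveringMatching

namespace SimpleGraph.IsCoveringMatching

variable {V : Type*} [Finite V] {G : SimpleGraph V} {m : V → V}

theorem closed_of_clique (h : G.IsCoveringMatching m) {Q : Finset V}
    (hQ : (G.pairingGraph m).IsNClique 4 Q) : Closed (G.pairingGraph m) (Q : Set V) :=
  fun _ hu _ huw => h.mem_of_adj_of_clique hQ hu huw

omit [Finite V] in
theorem Closed.union {F : SimpleGraph V} {A B : Set V} (hA : Closed F A) (hB : Closed F B) :
    Closed F (A ∪ B) := fun u hu w huw =>
  hu.imp (fun hu => hA u hu w huw) (fun hu => hB u hu w huw)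

omit [Finite V] in
theorem Closed.notMem_of_clique {F : SimpleGraph V} {A : Set V} (hA : Closed F A) {Q : Finset V}
    {n : ℕ} (hQ : F.IsNClique n Q) {u : V} (hu : u ∈ Q) (huA : u ∉ A) : ∀ v ∈ Q, v ∉ A := by
  intro v hv hvA
  by_cases e : v = u
  · exact huA (e ▸ hvA)
  · exact huA (hA v hvA u (hQ.1 hv hu e))

open Classical in
/-- Give `a` and `b` the colour `i`, the mate of `a` the colour `j`, the mate of `b` the colour `k`. -/
noncomputable def recolor (m : V → V) (c : V → Fin 3) (a b : V) (i j k : Fin 3) : V → Fin 3 :=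
  fun v => if v = a ∨ v = b then i else if v = m a then j else if v = m b then k else c v

section recolor

variable {Q : Finset V} {a b x : V} {c : V → Fin 3} {i j k : Fin 3}

theorem IsQuad.mates_ne (h : G.IsCoveringMatching m) (hq : IsQuad G m Q a b x) :
    m a ≠ a ∧ m b ≠ b ∧ m b ≠ a ∧ m b ≠ m a := by
  refine ⟨h.mate_ne_of_clique hq.clique ((hq.mem_iff a).2 (by simp)),
    h.mate_ne_of_clique hq.clique ((hq.mem_iff b).2 (by simp)), fun e => ?_, fun e => ?_⟩
  · exact hq.ne_mate (h.eq_mate_comm.1 e).symm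
  · exact hq.ne (by rw [← h.invol a, ← e, h.invol])

omit [Finite V] in
theorem recolor_of_notMem (hq : IsQuad G m Q a b x) {v : V} (hv : v ∉ Q) :
    recolor m c a b i j k v = c v := by
  rw [hq.mem_iff] at hv
  simp only [not_or] at hv
  simp [recolor, hv]

theorem recolor_eq (h : G.IsCoveringMatching m) (hq : IsQuad G m Q a b x) :
    recolor m c a b i j k a = i ∧ recolor m c a b i j k b = i ∧
      recolor m c a b i j k (m a) = j ∧ recolor m c a b i j k (m b) = k := by
  obtain ⟨h1, h2, h3, h4⟩ := hq.mates_ne h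
  simp [recolor, h1, h2, h3, h4, hq.ne_mate.symm]

omit [Finite V] in
/-- In a quadruple coloured like this, matched vertices have different colours. -/
theorem IsQuad.mate_colors (h : G.IsCoveringMatching m) (hq : IsQuad G m Q a b x)
    (hij : i ≠ j) (hik : i ≠ k) (ha : c a = i) (hb : c b = i) (hma : c (m a) = j)
    (hmb : c (m b) = k) : ∀ u ∈ Q, c u ≠ c (m u) := by
  intro u hu
  rcases (hq.mem_iff u).1 hu with rfl | rfl | rfl | rfl
  · rwa [ha, hma]
  · rw [h.invol, ha, hma]; exact hij.symm
  · rwa [hb, hmb]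
  · rw [h.invol, hb, hmb]; exact hik.symm

-- With `i`, `j`, `k` distinct, `a` and `b` are the only two vertices of `Q` sharing a colour, and
-- `x` is the only vertex that has both as unmatched neighbours.
omit [Finite V] in
theorem IsQuad.eq_center (hq : IsQuad G m Q a b x)
    (hij : i ≠ j) (hik : i ≠ k) (hjk : j ≠ k) (ha : c a = i) (hb : c b = i) (hma : c (m a) = j)
    (hmb : c (m b) = k) {v p q : V} (hp : p ∈ G.unmatchedNbrs m v) (hq' : q ∈ G.unmatchedNbrs m v)
    (hpq : p ≠ q) (hpQ : p ∈ Q) (hqQ : q ∈ Q) (e : c p = c q) : v = x ∧ c p = i := by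
  rcases (hq.mem_iff p).1 hpQ with rfl | rfl | rfl | rfl <;>
  rcases (hq.mem_iff q).1 hqQ with rfl | rfl | rfl | rfl <;>
  first
  | exact absurd rfl hpq
  | exact ⟨hq.unique v hp hq', ha⟩
  | exact ⟨hq.unique v hq' hp, hb⟩
  | (exfalso; simp_all)

end recolor

theorem exists_third_color (s t : Fin 3) : ∃ i j k : Fin 3, i ≠ s ∧ i ≠ t ∧ i ≠ j ∧ i ≠ k ∧ j ≠ k := by
  decide +revert

/-- Extend a good colouring to a quadruple whose centre is already coloured. -/
theorem GoodOn.extend (h : G.IsCoveringMatching m) {A : Set V} {c : V → Fin 3}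
    (hA : Closed (G.pairingGraph m) A) (hc : GoodOn G m A c) {Q : Finset V} {a b x : V}
    (hq : IsQuad G m Q a b x) (hQA : ∀ v ∈ Q, v ∉ A) (hx : x ∈ A) :
    ∃ c', GoodOn G m (A ∪ Q) c' := by
  obtain ⟨i, j, k, hs, ht, hij, hik, hjk⟩ := exists_third_color (c x) (c (m x))
  obtain ⟨ha, hb, hma, hmb⟩ := recolor_eq (c := c) (i := i) (j := j) (k := k) h hq
  have hcc : ∀ v ∈ A, recolor m c a b i j k v = c v := fun v hv =>
    recolor_of_notMem hq fun hvQ => hQA v hvQ hv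
  refine ⟨_, GoodOn.union h hA hc hcc
    (fun u hu _ => hq.mate_colors h hij hik ha hb hma hmb u hu) ?_⟩
  intro v p hp q hq' hpq hpQ hqQ e
  obtain ⟨rfl, hpi⟩ := hq.eq_center hij hik hjk ha hb hma hmb hp hq' hpq hpQ hqQ e
  rw [hpi, hcc _ hx, hcc _ (h.mate_mem_of_closed hA hx)]
  exact ⟨Or.inl hx, hs.symm, ht.symm⟩

/-- Extend a good colouring to two quadruples, each of which contains the centre of the other. -/
theorem GoodOn.extend_pair (h : G.IsCoveringMatching m) {A : Set V} {c : V → Fin 3}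
    (hA : Closed (G.pairingGraph m) A) (hc : GoodOn G m A c) {Q R : Finset V} {a b x y : V}
    (hq : IsQuad G m Q a b x) (hr : IsQuad G m R x y b) (hQR : ∀ v ∈ Q, v ∉ R)
    (hQA : ∀ v ∈ Q, v ∉ A) (hRA : ∀ v ∈ R, v ∉ A) :
    ∃ c', GoodOn G m (A ∪ (Q ∪ R)) c' := by
  -- The repeated colour of `Q` is 0, while its centre `x` and the mate of `x` get 1 and 2. The
  -- repeated colour of `R` is 1, while its centre `b` and the mate of `b` get 0 and 2.
  obtain ⟨ha, hb, hma, hmb⟩ := recolor_eq (c := c) (i := 0) (j := 1) (k := 2) h hq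
  set c₁ := recolor m c a b 0 1 2 with hc₁
  obtain ⟨hx, hy, hmx, hmy⟩ := recolor_eq (c := c₁) (i := 1) (j := 2) (k := 0) h hr
  have hQc : ∀ v ∈ Q, recolor m c₁ x y 1 2 0 v = c₁ v := fun v hv =>
    recolor_of_notMem hr (hQR v hv)
  have hcc : ∀ v ∈ A, recolor m c₁ x y 1 2 0 v = c v := fun v hv => by
    rw [recolor_of_notMem hr fun hvR => hRA v hvR hv, hc₁,
      recolor_of_notMem hq fun hvQ => hQA v hvQ hv]
  rw [← hQc _ ((hq.mem_iff _).2 (by simp))] at ha hb hma hmb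
  have hbR : b ∈ Q := (hq.mem_iff _).2 (by simp)
  have hxR : x ∈ R := (hr.mem_iff _).2 (by simp)
  refine ⟨_, GoodOn.union h hA hc hcc ?_ ?_⟩
  · rintro u (hu | hu) _
    · exact hq.mate_colors h (by decide) (by decide) ha hb hma hmb u hu
    · exact hr.mate_colors h (by decide) (by decide) hx hy hmx hmy u hu
  · intro v p hp q hq' hpq hpQ hqQ e
    have hadj := h.pairingGraph_adj_of_mem hpq hp hq'
    rcases hpQ with hpQ | hpQ
    · have hqQ' : q ∈ Q := h.mem_of_adj_of_clique hq.clique hpQ hadj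
      obtain ⟨rfl, hpi⟩ := hq.eq_center (by decide) (by decide) (by decide) ha hb hma hmb
        hp hq' hpq hpQ hqQ' e
      rw [hpi, hx, hmx]
      exact ⟨Or.inr (Or.inr hxR), by decide, by decide⟩
    · have hqQ' : q ∈ R := h.mem_of_adj_of_clique hr.clique hpQ hadj
      obtain ⟨rfl, hpi⟩ := hr.eq_center (by decide) (by decide) (by decide) hx hy hmx hmy
        hp hq' hpq hpQ hqQ' e
      rw [hpi, hb, hmb]
      exact ⟨Or.inr (Or.inl hbR), by decide, by decide⟩

theorem exists_isQuad (h : G.IsCoveringMatching m) {Q : Finset V}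
    (hQ : (G.pairingGraph m).IsNClique 4 Q) {a : V} (ha : a ∈ Q) :
    ∃ b x, IsQuad G m Q a b x := by
  classical
  obtain ⟨b, hb, hbQ⟩ : ∃ b ∈ Q, b ∉ ({a, m a} : Finset V) := by
    by_contra! hcon
    have h1 := Finset.card_le_card hcon
    have h2 := Finset.card_le_two (a := a) (b := m a)
    rw [hQ.2] at h1
    omega
  simp only [Finset.mem_insert, Finset.mem_singleton, not_or] at hbQ
  obtain ⟨-, h3 | ⟨x, hax, hbx⟩⟩ := h.pairingGraph_adj_iff.1 (hQ.1 ha hb (Ne.symm hbQ.1))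
  · exact absurd h3.symm hbQ.2
  · exact ⟨b, x, h.isQuad_of_clique hQ ha (Ne.symm hbQ.1) hbQ.2 hax hbx⟩

/-- If the centre of a quadruple lies in a 4-clique, then that clique is a quadruple with a centre
in the first one. -/
theorem IsQuad.exists_opposite (h : G.IsCoveringMatching m) {Q R : Finset V} {a b x : V}
    (hq : IsQuad G m Q a b x) (hR : (G.pairingGraph m).IsNClique 4 R) (hx : x ∈ R) :
    (∃ y, IsQuad G m R x y b) ∧ ∀ v ∈ Q, v ∉ R := by
  obtain ⟨h1, h2, h3, h4⟩ := hq.mates_ne h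
  have hbx := h.mem_unmatchedNbrs_comm.1 hq.right
  have hax := h.mem_unmatchedNbrs_comm.1 hq.left
  constructor
  -- In the clique, `b` and `m a` are adjacent without being mates, so they are unmatched neighbours
  -- of some `y`. Then `x` and `y` are unmatched neighbours of `b`, which is therefore a centre for
  -- `R`.
  · have hadj := hq.clique.1 ((hq.mem_iff b).2 (by simp)) ((hq.mem_iff (m a)).2 (by simp))
      hq.ne_mate
    obtain ⟨-, h5 | ⟨y, hby, hay⟩⟩ := h.pairingGraph_adj_iff.1 hadj
    · exact absurd h5 h4
    · have hxy : x ≠ y := by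
        rintro rfl
        rcases h.eq_of_mem_unmatchedNbrs hq.left hq.right hay hq.ne with h6 | h6
        · exact h1 h6
        · exact hq.ne_mate h6.symm
      have hyb := h.mem_unmatchedNbrs_comm.1 hby
      refine ⟨y, h.isQuad_of_clique hR hx hxy ?_ hbx hyb⟩
      rintro rfl
      exact h.mate_notMem_of_clique hR hx hq.right hyb
  · have hxQ : x ∉ Q := by
      rw [hq.mem_iff]
      rintro (rfl | rfl | rfl | rfl)
      · exact hq.left.1.ne rfl
      · exact hq.left.2 (h.invol a)
      · exact hq.right.1.ne rfl
      · exact hq.right.2 (h.invol b)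
    intro v hv hvR
    by_cases e : v = x
    · exact hxQ (e ▸ hv)
    · exact hxQ (h.mem_of_adj_of_clique hq.clique hv (hR.1 hvR hx e))

theorem exists_goodOn_univ (h : G.IsCoveringMatching m) : ∃ c, GoodOn G m Set.univ c := by
  classical
  let K : Set V := {v | ∃ Q, (G.pairingGraph m).IsNClique 4 Q ∧ v ∈ Q}
  suffices main : ∀ (n : ℕ) (A : Set V) (c : V → Fin 3), Aᶜ.ncard = n → Kᶜ ⊆ A →
      Closed (G.pairingGraph m) A → GoodOn G m A c → ∃ c', GoodOn G m Set.univ c' by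
    let F : SimpleGraph V :=
      { Adj := fun u w => (G.pairingGraph m).Adj u w ∧ u ∉ K ∧ w ∉ K
        symm := ⟨fun u w h => ⟨h.1.symm, h.2.2, h.2.1⟩⟩
        loopless := ⟨fun u h => h.1.ne rfl⟩ }
    -- Brooks' theorem colours the complement of the 4-cliques; `main` then adds one or two cliques
    -- at a time.
    have hKcl : Closed (G.pairingGraph m) Kᶜ := by
      rintro u hu w huw ⟨Q, hQ, hw⟩
      exact hu ⟨Q, hQ, h.mem_of_adj_of_clique hQ hw huw.symm⟩
    obtain ⟨c, hc⟩ := SimpleGraph.colorable_three_of_cliqueFree_four (F := F)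
      (fun v => (Set.ncard_le_ncard (fun w hw => hw.1) (Set.toFinite _)).trans
        (h.ncard_neighborSet_pairingGraph_le v)) (by
        intro Q hQ
        have hQ' : (G.pairingGraph m).IsNClique 4 Q :=
          ⟨fun u hu w hw hne => (hQ.1 hu hw hne).1, hQ.2⟩
        obtain ⟨u, hu, w, hw, hne⟩ := Finset.one_lt_card.1 (by rw [hQ.2]; decide)
        exact (hQ.1 hu hw hne).2.1 ⟨Q, hQ', hu⟩)
    refine main _ Kᶜ c rfl le_rfl hKcl ⟨?_, ?_⟩
    · intro u hu hm
      exact hc _ _ ⟨h.pairingGraph_adj_mate hm, hu, h.mate_mem_of_closed hKcl hu⟩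
    · intro v p hp q hq hpq hpA hqA e
      exact absurd e (hc _ _ ⟨h.pairingGraph_adj_of_mem hpq hp hq, hpA, hqA⟩)
  intro n
  induction n using Nat.strong_induction_on with
  | _ n ih =>
    intro A c hn hKA hA hc
    by_cases hu : ∃ u, u ∉ A
    · obtain ⟨u, hu⟩ := hu
      obtain ⟨Q, hQ, huQ⟩ : u ∈ K := by
        by_contra h'
        exact hu (hKA h')
      obtain ⟨b, x, hq⟩ := h.exists_isQuad hQ huQ
      have hQA := hA.notMem_of_clique hQ huQ hu
      have hlt : ∀ B : Set V, u ∈ B → (A ∪ B)ᶜ.ncard < n := by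
        intro B huB
        rw [← hn]
        refine Set.ncard_lt_ncard ⟨Set.compl_subset_compl.2 Set.subset_union_left, fun hs => ?_⟩
          (Set.toFinite _)
        exact hs hu (Or.inr huB)
      by_cases hx : x ∈ A
      · obtain ⟨c', hc'⟩ := hc.extend h hA hq hQA hx
        exact ih _ (hlt Q huQ) _ c' rfl (hKA.trans Set.subset_union_left)
          (hA.union (h.closed_of_clique hQ)) hc'
      · obtain ⟨R, hR, hxR⟩ : x ∈ K := by
          by_contra h'
          exact hx (hKA h')
        obtain ⟨⟨y, hr⟩, hQR⟩ := hq.exists_opposite h hR hxR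
        obtain ⟨c', hc'⟩ := hc.extend_pair h hA hq hr hQR hQA (hA.notMem_of_clique hR hxR hx)
        exact ih _ (hlt (Q ∪ R) (Or.inl huQ)) _ c' rfl (hKA.trans Set.subset_union_left)
          (hA.union ((h.closed_of_clique hQ).union (h.closed_of_clique hR))) hc'
    · push Not at hu
      exact ⟨c, by rwa [Set.eq_univ_of_forall hu] at hc⟩

end SimpleGraph.IsCoveringMatching

/-! ### From covering matchings to packing colourings -/

/-- A vertex colouring for which no closed neighbourhood contains three vertices of one colour. -/
def SimpleGraph.IsPackingColoring {V : Type*} (G : SimpleGraph V) (c : V → Fin 3) : Prop :=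
  ∀ v p q r, (p = v ∨ G.Adj v p) → (q = v ∨ G.Adj v q) → (r = v ∨ G.Adj v r) →
    p ≠ q → p ≠ r → q ≠ r → c p = c q → c p = c r → False

theorem SimpleGraph.IsCoveringMatching.exists_isPackingColoring {V : Type*} [Finite V]
    {G : SimpleGraph V} {m : V → V} (h : G.IsCoveringMatching m) :
    ∃ c, G.IsPackingColoring c := by
  obtain ⟨c, hc1, hc2⟩ := h.exists_goodOn_univ
  refine ⟨c, ?_⟩
  intro v
  have hmem : ∀ p, (p = v ∨ G.Adj v p) → p = v ∨ p = m v ∨ p ∈ G.unmatchedNbrs m v := by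
    rintro p (hp | hp)
    · exact Or.inl hp
    · by_cases e : p = m v
      · exact Or.inr (Or.inl e)
      · exact Or.inr (Or.inr ⟨hp, Ne.symm e⟩)
  have htwo : ∀ p q r, (r = v ∨ r = m v ∨ r ∈ G.unmatchedNbrs m v) → p ∈ G.unmatchedNbrs m v →
      q ∈ G.unmatchedNbrs m v → p ≠ q → p ≠ r → q ≠ r → c p = c q → c p = c r → False := by
    intro p q r hr hp hq hpq hpr hqr e1 e2
    obtain ⟨-, h3, h4⟩ := hc2 v p hp q hq hpq trivial trivial e1
    rcases hr with rfl | rfl | hr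
    · exact h3 e2.symm
    · exact h4 e2.symm
    · exact (h.eq_of_mem_unmatchedNbrs hp hq hr hpq).elim hpr.symm hqr.symm
  have hmate : ∀ p q, (p = v ∨ p = m v) → (q = v ∨ q = m v) → p ≠ q → c p ≠ c q := by
    rintro p q (rfl | rfl) (rfl | rfl) hne
    · exact absurd rfl hne
    · exact hc1 _ trivial hne.symm
    · exact (hc1 _ trivial hne).symm
    · exact absurd rfl hne
  intro p q r hp hq hr hpq hpr hqr e1 e2
  replace hp := hmem p hp
  replace hq := hmem q hq
  replace hr := hmem r hr
  rw [← or_assoc] at hp hq hr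
  rcases hp with hp' | hp' <;> rcases hq with hq' | hq'
  · exact hmate p q hp' hq' hpq e1
  · rcases hr with hr' | hr'
    · exact hmate p r hp' hr' hpr e2
    · exact htwo q r p (or_assoc.1 (Or.inl hp')) hq' hr' hqr hpq.symm hpr.symm
        (e1.symm.trans e2) e1.symm
  · rcases hr with hr' | hr'
    · exact hmate q r hq' hr' hqr (e1.symm.trans e2)
    · exact htwo p r q (or_assoc.1 (Or.inl hq')) hp' hr' hpr hpq hqr.symm e2 e1
  · exact htwo p q r (or_assoc.1 hr) hp' hq' hpq hpr hqr e1 e2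

/-! ### Bridges and the reduction to even order -/

theorem exists_perm_avoiding (r s x y : Fin 3) : ∃ π : Equiv.Perm (Fin 3), π r ≠ x ∧ π y ≠ s := by
  decide +revert

namespace SimpleGraph

variable {V : Type*} [Finite V] {G : SimpleGraph V}

/-- If one neighbour of `u` is disregarded, then at most one colour is repeated in its closed
neighbourhood. -/
theorem exists_repeated_color (c : V → Fin 3) {u v : V} (hu : (G.neighborSet u).ncard ≤ 3)
    (huv : G.Adj u v) :
    ∃ r, ∀ p q, (p = u ∨ G.Adj u p) → (q = u ∨ G.Adj u q) → p ≠ v → q ≠ v → p ≠ q → c p = c q →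
      c p = r := by
  by_contra! hcon
  -- The value 0 is arbitrary and only yields a first repeated pair; a second pair of another colour
  -- would need four vertices where there are at most three.
  obtain ⟨p, q, hp, hq, hpv, hqv, hpq, e, -⟩ := hcon 0
  obtain ⟨p', q', hp', hq', hpv', hqv', hpq', e', hne⟩ := hcon (c p)
  have h1 : (insert u (G.neighborSet u)).ncard ≤ 4 :=
    (Set.ncard_insert_le _ _).trans (by omega)
  have h2 := Set.ncard_sdiff_singleton_add_one (s := insert u (G.neighborSet u)) (a := v)
    (Or.inr huv) (Set.toFinite _)
  have h3 : ({p, q, p', q'} : Set V) ⊆ insert u (G.neighborSet u) \ {v} := by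
    rintro w (rfl | rfl | rfl | rfl)
    · exact ⟨hp, hpv⟩
    · exact ⟨hq, hqv⟩
    · exact ⟨hp', hpv'⟩
    · exact ⟨hq', hqv'⟩
  have h4 := Set.ncard_le_ncard h3 (Set.toFinite _)
  have h5 : ({p, q, p', q'} : Set V).ncard = 4 := by
    have a1 : p ≠ p' := fun h => hne (by rw [h])
    have a2 : p ≠ q' := fun h => hne (by rw [e', h])
    have a3 : q ≠ p' := fun h => hne (by rw [e, h])
    have a4 : q ≠ q' := fun h => hne (by rw [e', e, h])
    rw [Set.ncard_insert_of_notMem (by simp [hpq, a1, a2]),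
      Set.ncard_insert_of_notMem (by simp [a3, a4]), Set.ncard_pair hpq']
  omega

/-- A packing colouring of `G` minus a bridge yields one of `G`. -/
theorem exists_isPackingColoring_of_bridge (hG : ∀ v, (G.neighborSet v).ncard ≤ 3)
    {C : Set V} {u v : V} (hC : G.outEdges C = {(u, v)}) {c : V → Fin 3}
    (hc : (G.deleteEdges {s(u, v)}).IsPackingColoring c) : ∃ c, G.IsPackingColoring c := by
  classical
  have hmem : ∀ a b, a ∈ C → b ∉ C → G.Adj a b → a = u ∧ b = v := by
    intro a b ha hb hab
    have : (a, b) ∈ G.outEdges C := ⟨ha, hb, hab⟩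
    rw [hC] at this
    simpa using this
  obtain ⟨huC, hvC, huv⟩ : u ∈ C ∧ v ∉ C ∧ G.Adj u v := by
    have : (u, v) ∈ G.outEdges C := by rw [hC]; rfl
    exact this
  obtain ⟨r, hr⟩ := exists_repeated_color c (hG u) huv
  obtain ⟨s, hs⟩ := exists_repeated_color c (hG v) huv.symm
  -- Recolouring the side of `u` by `π` keeps `c v` away from the colour repeated at `u`, and the
  -- new colour of `u` away from the one repeated at `v`.
  obtain ⟨π, h1, h2⟩ := exists_perm_avoiding r s (c v) (c u)
  have hnb : ∀ w, ∀ p, (p = w ∨ G.Adj w p) → ¬ (w = u ∧ p = v) → ¬ (w = v ∧ p = u) →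
      (p = w ∨ (G.deleteEdges {s(u, v)}).Adj w p) ∧ (p ∈ C ↔ w ∈ C) := by
    intro w p hp n1 n2
    rcases hp with rfl | hp
    · simp
    · refine ⟨Or.inr ?_, ?_⟩
      · rw [deleteEdges_adj]
        refine ⟨hp, ?_⟩
        simp only [Set.mem_singleton_iff, Sym2.eq_iff]
        exact not_or.2 ⟨n1, n2⟩
      · by_contra hcon
        by_cases hw : w ∈ C
        · exact n1 (hmem w p hw (fun h => hcon (iff_of_true h hw)) hp)
        · exact n2 (hmem p w (not_not.1 fun h => hcon (iff_of_false h hw)) hw hp.symm).symm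
  let c' : V → Fin 3 := fun w => if w ∈ C then π (c w) else c w
  have hcc : ∀ p q, (p ∈ C ↔ q ∈ C) → c' p = c' q → c p = c q := by
    intro p q hpq e
    by_cases hq : q ∈ C
    · simpa [c', hq, hpq.2 hq] using e
    · simpa [c', hq, mt hpq.1 hq] using e
  have hexc : ∀ w p q r, (p = w ∨ G.Adj w p) → (q = w ∨ G.Adj w q) → p ≠ q → p ≠ r → q ≠ r →
      ((w = u ∧ r = v) ∨ (w = v ∧ r = u)) → c' p = c' q → c' p = c' r → False := by
    rintro w p q r' hp hq hpq hpr hqr (⟨rfl, rfl⟩ | ⟨rfl, rfl⟩) e1 e2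
    · have hp' := (hnb w p hp (fun h => hpr h.2) (fun h => huv.ne h.1)).2.2 huC
      have hq' := (hnb w q hq (fun h => hqr h.2) (fun h => huv.ne h.1)).2.2 huC
      have h3 := hr p q hp hq hpr hqr hpq (hcc p q (iff_of_true hp' hq') e1)
      simp only [c', hp', hvC, if_true, if_false] at e2
      exact h1 (by rw [← h3, e2])
    · have hp' := mt (hnb w p hp (fun h => huv.ne h.1.symm) (fun h => hpr h.2)).2.1 hvC
      have hq' := mt (hnb w q hq (fun h => huv.ne h.1.symm) (fun h => hqr h.2)).2.1 hvC
      have h3 := hs p q hp hq hpr hqr hpq (hcc p q (iff_of_false hp' hq') e1)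
      simp only [c', hp', huC, if_true, if_false] at e2
      exact h2 (by rw [← h3, e2])
  refine ⟨c', ?_⟩
  intro w p q r hp hq hr hpq hpr hqr e1 e2
  by_cases n1 : (w = u ∧ p = v) ∨ (w = v ∧ p = u)
  · exact hexc w q r p hq hr hqr hpq.symm hpr.symm n1 (e1.symm.trans e2) e1.symm
  by_cases n2 : (w = u ∧ q = v) ∨ (w = v ∧ q = u)
  · exact hexc w p r q hp hr hpr hpq hqr.symm n2 e2 e1
  by_cases n3 : (w = u ∧ r = v) ∨ (w = v ∧ r = u)
  · exact hexc w p q r hp hq hpq hpr hqr n3 e1 e2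
  rw [not_or] at n1 n2 n3
  -- A triple that does not use the bridge lies on one side of the cut, where `π` does not affect
  -- which colours agree.
  obtain ⟨p1, p2⟩ := hnb w p hp n1.1 n1.2
  obtain ⟨q1, q2⟩ := hnb w q hq n2.1 n2.2
  obtain ⟨r1, r2⟩ := hnb w r hr n3.1 n3.2
  exact hc w p q r p1 q1 r1 hpq hpr hqr (hcc p q (p2.trans q2.symm) e1)
    (hcc p r (p2.trans r2.symm) e2)

theorem exists_isPackingColoring_of_even (hV : Even (Nat.card V)) (G : SimpleGraph V) :
    (∀ v, (G.neighborSet v).ncard ≤ 3) → ∃ c, G.IsPackingColoring c := by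
  induction G using WellFoundedLT.induction with
  | _ G ih =>
    intro hG
    by_cases hcut : ∃ C : Set V, (G.outEdges C).ncard = 1
    · obtain ⟨C, hC⟩ := hcut
      obtain ⟨⟨u, v⟩, hC⟩ := Set.ncard_eq_one.1 hC
      have huv : G.Adj u v := by
        have : (u, v) ∈ G.outEdges C := by rw [hC]; rfl
        exact this.2.2
      have hle : G.deleteEdges {s(u, v)} ≤ G := deleteEdges_le _
      have hlt : G.deleteEdges {s(u, v)} < G := by
        refine lt_of_le_of_ne hle fun e => ?_
        rw [← e, deleteEdges_adj] at huv
        exact huv.2 rfl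
      obtain ⟨c, hc⟩ := ih _ hlt fun w =>
        (Set.ncard_le_ncard (fun x hx => hle hx) (Set.toFinite _)).trans (hG w)
      exact exists_isPackingColoring_of_bridge hG hC hc
    · push Not at hcut
      obtain ⟨m, h1, h2, h3⟩ := exists_matching_of_no_bridge hG hV hcut
      exact IsCoveringMatching.exists_isPackingColoring ⟨hG, h1, h2, h3⟩

/-- Every subcubic graph has a vertex partition into three 2-limited packings. -/
theorem exists_isPackingColoring (hG : ∀ v, (G.neighborSet v).ncard ≤ 3) :
    ∃ c, G.IsPackingColoring c := by
  -- The second copy of `V` consists of isolated vertices and only makes the order even.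
  let H : SimpleGraph (V ⊕ V) := G.map Function.Embedding.inl
  have hV : Even (Nat.card (V ⊕ V)) := by
    rw [Nat.card_sum]
    exact ⟨_, rfl⟩
  obtain ⟨c, hc⟩ := exists_isPackingColoring_of_even hV H (by
    rintro (v | v)
    · have : H.neighborSet (Sum.inl v) = Sum.inl '' G.neighborSet v := by
        ext w
        simp [H, map_adj]
      rw [this, Set.ncard_image_of_injective _ Sum.inl_injective]
      exact hG v
    · have : H.neighborSet (Sum.inr v) = ∅ := by
        ext w
        simp [H, map_adj]
      simp [this])
  refine ⟨fun v => c (Sum.inl v), ?_⟩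
  have hadj : ∀ v p, (p = v ∨ G.Adj v p) →
      ((Sum.inl p : V ⊕ V) = Sum.inl v ∨ H.Adj (Sum.inl v) (Sum.inl p)) := by
    rintro v p (rfl | h)
    · exact Or.inl rfl
    · exact Or.inr (by simpa [H, map_adj] using h)
  intro v p q r hp hq hr hpq hpr hqr
  exact hc _ _ _ _ (hadj v p hp) (hadj v q hq) (hadj v r hr) (by simpa using hpq)
    (by simpa using hpr) (by simpa using hqr)

end SimpleGraph

/-! ### Limited packings and double domination -/

section Packing

variable {V : Type u} [Fintype V] [DecidableEq V] {G : SimpleGraph V} [DecidableRel G.Adj]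

theorem mem_closedNbhd {v w : V} : w ∈ closedNbhd G v ↔ w = v ∨ G.Adj v w := by
  simp [closedNbhd]

theorem SimpleGraph.IsPackingColoring.isLimitedPacking {c : V → Fin 3}
    (hc : G.IsPackingColoring c) (t : Fin 3) :
    IsLimitedPacking G 2 (Finset.univ.filter fun v => c v = t) := by
  intro v
  by_contra! h
  obtain ⟨p, q, r, hp, hq, hr, hpq, hpr, hqr⟩ := Finset.two_lt_card_iff.1 h
  simp only [Finset.mem_inter, Finset.mem_filter, Finset.mem_univ, true_and,
    mem_closedNbhd] at hp hq hr
  exact hc v p q r hp.1 hq.1 hr.1 hpq hpr hqr (hp.2.trans hq.2.symm) (hp.2.trans hr.2.symm)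

theorem IsLimitedPacking.card_le {k : ℕ} {X : Finset V} (hX : IsLimitedPacking G k X) :
    X.card ≤ limitedPackingNumber G k :=
  (isGreatest_limitedPackingNumber G k).2 ⟨X, hX, rfl⟩

theorem card_le_three_mul_limitedPackingNumber (hG : ∀ v, G.degree v ≤ 3) :
    Fintype.card V ≤ 3 * limitedPackingNumber G 2 := by
  obtain ⟨c, hc⟩ := G.exists_isPackingColoring fun v => by
    rw [Set.ncard_eq_toFinset_card', ← SimpleGraph.neighborFinset_def]
    exact hG v
  have h := Finset.card_eq_sum_card_fiberwise (f := c) (s := Finset.univ) (t := Finset.univ)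
    (fun _ _ => Finset.mem_coe.2 (Finset.mem_univ _))
  rw [Finset.card_univ, Fin.sum_univ_three] at h
  have h0 := (hc.isLimitedPacking 0).card_le
  have h1 := (hc.isLimitedPacking 1).card_le
  have h2 := (hc.isLimitedPacking 2).card_le
  omega

theorem card_closedNbhd_of_cubic (hG : G.IsRegularOfDegree 3) (v : V) :
    (closedNbhd G v).card = 4 := by
  rw [closedNbhd, Finset.card_insert_of_notMem (by simp),
    SimpleGraph.card_neighborFinset_eq_degree, hG.degree_eq v]

theorem isTupleDominating_compl_iff (hG : G.IsRegularOfDegree 3) (X : Finset V) :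
    IsTupleDominating G 2 Xᶜ ↔ IsLimitedPacking G 2 X := by
  refine forall_congr' fun v => ?_
  have h1 := Finset.card_inter_add_card_sdiff (closedNbhd G v) X
  rw [card_closedNbhd_of_cubic hG, Finset.sdiff_eq_inter_compl] at h1
  omega

theorem limitedPackingNumber_add_tupleDominationNumber (hG : G.IsRegularOfDegree 3) :
    limitedPackingNumber G 2 + tupleDominationNumber G 2 = Fintype.card V := by
  obtain ⟨⟨X, hX, hXc⟩, hmax⟩ := isGreatest_limitedPackingNumber G 2
  obtain ⟨⟨D, hD, hDc⟩, hmin⟩ := isLeast_tupleDominationNumber G 3 2 hG (by norm_num)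
  have h1 := hmin ⟨Xᶜ, (isTupleDominating_compl_iff hG X).2 hX, rfl⟩
  have h2 := hmax ⟨Dᶜ, (isTupleDominating_compl_iff hG Dᶜ).1 (by rwa [compl_compl]), rfl⟩
  have h3 := Finset.card_add_card_compl X
  have h4 := Finset.card_add_card_compl D
  omega

end Packing

/-! ### Tightness: disjoint copies of `K_{3,3}` -/

theorem disjointCopies_adj {V : Type u} {m : ℕ} {G : SimpleGraph V} {p q : Fin m × V} :
    (disjointCopies m G).Adj p q ↔ p.1 = q.1 ∧ G.Adj p.2 q.2 :=
  Iff.rfl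

theorem closedNbhd_disjointCopies {V : Type u} [Fintype V] [DecidableEq V] (m : ℕ)
    (G : SimpleGraph V) [DecidableRel G.Adj] (i : Fin m) (v : V) :
    closedNbhd (disjointCopies m G) (i, v) =
      (closedNbhd G v).map (Function.Embedding.sectR i V) := by
  ext ⟨j, w⟩
  simp only [mem_closedNbhd, disjointCopies_adj, Finset.mem_map, Function.Embedding.sectR_apply,
    Prod.mk.injEq]
  constructor
  · rintro (⟨rfl, rfl⟩ | ⟨rfl, h⟩)
    · exact ⟨w, Or.inl rfl, rfl, rfl⟩
    · exact ⟨w, Or.inr h, rfl, rfl⟩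
  · rintro ⟨w, rfl | h, rfl, rfl⟩
    · exact Or.inl ⟨rfl, rfl⟩
    · exact Or.inr ⟨rfl, h⟩

theorem isRegularOfDegree_disjointCopies {V : Type u} [Fintype V] [DecidableEq V] (m : ℕ)
    {G : SimpleGraph V} [DecidableRel G.Adj] {d : ℕ} (hG : G.IsRegularOfDegree d) :
    (disjointCopies m G).IsRegularOfDegree d := by
  rintro ⟨i, v⟩
  have h := congrArg Finset.card (closedNbhd_disjointCopies m G i v)
  rw [Finset.card_map, closedNbhd, closedNbhd, Finset.card_insert_of_notMem (by simp),
    Finset.card_insert_of_notMem (by simp), SimpleGraph.card_neighborFinset_eq_degree,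
    SimpleGraph.card_neighborFinset_eq_degree, hG v] at h
  omega

theorem isRegularOfDegree_graphH6 : graphH6.IsRegularOfDegree 3 := by
  intro v
  rw [← SimpleGraph.card_neighborFinset_eq_degree, SimpleGraph.neighborFinset_eq_filter]
  revert v
  decide

/-- In `K_{3,3}` a closed neighbourhood is a vertex together with the opposite side, so any three
vertices lie in a common one. -/
theorem IsLimitedPacking.card_le_two_of_graphH6 {X : Finset (Fin 6)}
    (hX : IsLimitedPacking graphH6 2 X) : X.card ≤ 2 := by
  have key : ∀ X : Finset (Fin 6),
      (∀ v, ((Finset.univ.filter fun w => w = v ∨ graphH6.Adj v w) ∩ X).card ≤ 2) →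
      X.card ≤ 2 := by
    decide
  refine key X fun v => ?_
  convert hX v using 3
  ext w
  simp [mem_closedNbhd]

theorem limitedPackingNumber_disjointCopies_graphH6_le (m : ℕ) :
    limitedPackingNumber (disjointCopies m graphH6) 2 ≤ 2 * m := by
  obtain ⟨⟨X, hX, hXc⟩, -⟩ := isGreatest_limitedPackingNumber (disjointCopies m graphH6) 2
  rw [← hXc, Finset.card_eq_sum_card_fiberwise (f := Prod.fst) (t := Finset.univ)
    (fun _ _ => Finset.mem_coe.2 (Finset.mem_univ _))]
  calc _ ≤ ∑ _i : Fin m, 2 := Finset.sum_le_sum fun i _ => ?_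
    _ = 2 * m := by simp [mul_comm]
  have h1 : X.filter (fun p => p.1 = i) =
      (Finset.univ.filter fun v => (i, v) ∈ X).map (Function.Embedding.sectR i (Fin 6)) := by
    ext ⟨j, v⟩
    simp only [Finset.mem_filter, Finset.mem_map, Finset.mem_univ, true_and,
      Function.Embedding.sectR_apply, Prod.mk.injEq]
    constructor
    · rintro ⟨h, rfl⟩
      exact ⟨v, h, rfl, rfl⟩
    · rintro ⟨v, h, rfl, rfl⟩
      exact ⟨h, rfl⟩
  rw [h1, Finset.card_map]
  refine IsLimitedPacking.card_le_two_of_graphH6 fun v => ?_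
  refine le_trans ?_ (hX (i, v))
  rw [closedNbhd_disjointCopies]
  refine Finset.card_le_card_of_injOn (fun w => (i, w)) ?_ (fun a _ b _ h => (Prod.ext_iff.1 h).2)
  intro w hw
  simpa using hw

theorem mainTheorem2 :
    -- the lower bound for graphs of maximum degree 3
    (∀ (V : Type u) [Fintype V] [DecidableEq V] (G : SimpleGraph V) [DecidableRel G.Adj],
      G.maxDegree = 3 → (Fintype.card V : ℝ) / 3 ≤ (limitedPackingNumber G 2 : ℝ)) ∧
    -- the form for cubic graphs in terms of double domination
    (∀ (V : Type u) [Fintype V] [DecidableEq V] (G : SimpleGraph V) [DecidableRel G.Adj],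
      G.IsRegularOfDegree 3 →
        limitedPackingNumber G 2 + tupleDominationNumber G 2 = Fintype.card V ∧
        (tupleDominationNumber G 2 : ℝ) ≤ 2 * (Fintype.card V : ℝ) / 3) ∧
    -- both bounds are attained by `m` disjoint copies of `H_6`, for every `m ≥ 1`
    (∀ m : ℕ, 1 ≤ m →
      (disjointCopies m graphH6).IsRegularOfDegree 3 ∧
      (disjointCopies m graphH6).maxDegree = 3 ∧
      (limitedPackingNumber (disjointCopies m graphH6) 2 : ℝ) =
        (Fintype.card (Fin m × Fin 6) : ℝ) / 3 ∧
      (tupleDominationNumber (disjointCopies m graphH6) 2 : ℝ) =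
        2 * (Fintype.card (Fin m × Fin 6) : ℝ) / 3) := by
  refine ⟨?_, ?_, ?_⟩
  · intro V _ _ G _ hG
    have h := card_le_three_mul_limitedPackingNumber (G := G)
      fun v => hG ▸ G.degree_le_maxDegree v
    have h' : (Fintype.card V : ℝ) ≤ 3 * limitedPackingNumber G 2 := by exact_mod_cast h
    linarith
  · intro V _ _ G _ hG
    have h1 := limitedPackingNumber_add_tupleDominationNumber hG
    have h2 := card_le_three_mul_limitedPackingNumber (G := G) fun v => (hG v).le
    refine ⟨h1, ?_⟩
    have h3 : 3 * tupleDominationNumber G 2 ≤ 2 * Fintype.card V := by omega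
    have h3' : 3 * (tupleDominationNumber G 2 : ℝ) ≤ 2 * Fintype.card V := by exact_mod_cast h3
    linarith
  · intro m hm
    -- This is where `1 ≤ m` matters: the maximum degree of the empty graph would be 0.
    have : Nonempty (Fin m × Fin 6) := ⟨(⟨0, hm⟩, 0)⟩
    have hreg := isRegularOfDegree_disjointCopies m isRegularOfDegree_graphH6
    have h1 := limitedPackingNumber_add_tupleDominationNumber hreg
    have h2 := card_le_three_mul_limitedPackingNumber fun v => (hreg v).le
    have h3 := limitedPackingNumber_disjointCopies_graphH6_le m
    have hcard : Fintype.card (Fin m × Fin 6) = m * 6 := by simp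
    rw [hcard] at h1 h2 ⊢
    have h4 : limitedPackingNumber (disjointCopies m graphH6) 2 = 2 * m := by omega
    have h5 : tupleDominationNumber (disjointCopies m graphH6) 2 = 4 * m := by omega
    refine ⟨hreg, hreg.maxDegree_eq, ?_, ?_⟩
    · rw [h4]; push_cast; ring
    · rw [h5]; push_cast; ring
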